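/- For $\nu\in(0,1)$ let $m=\tfrac{3}{16}(1-\nu)$. (1) There is a unique even positive function $r=r(\cdot,\nu)\in C^2(\mathbb{R})$ which tends to $0$ at $\pm\infty$ and satisfies $$-m r''+m r-r^3+r^5=0\quad\text{on }\mathbb{R}.$$ For this $r$ there are a unique $\theta=\theta(\nu)\in\mathbb{R}$ and a unique $q=q(\cdot,\nu)\in H^2(\mathbb{R})$ such that $$-m q''+m q-r^2q+r^4q=r^3-\theta r,\qquad \int_{\mathbb{R}} q\,r\,dx=0 .$$ (2) Parametrize $\nu=4e^{-4L}$, that is, $L=\tfrac14\ln\tfrac4\nu$ with $L>\tfrac14\ln 4$. For each fixed $x$ the number $r(x,4e^{-4L})$ is differentiable in $L$; put $\sigma(x)=\dfrac{\partial}{\partial L}\,r(x,4e^{-4L})$ and $$a(L)=\int_{\mathbb{R}}\bigl(r^2q+2r^3q^2-rq^2-\theta q\bigr)\,\sigma\,dx ,$$ where $r,q,\theta$ are taken at $\nu=4e^{-4L}$. The integral converges absolutely, $a$ is a differentiable function of $L$ on $(\tfrac14\ln 4,\infty)$, and $$\frac{\partial a}{\partial L}=\frac{3\pi^2}{32L^2}+O\bigl(L^{-5/2}\bigr)\qquad\text{as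 } L\to\infty .$$ -/

import Mathlib

open MeasureTheory Filter Topology Asymptotics

noncomputable section

namespace QuinticGL

/-- The coefficient `m = (3/16)(1 - ν)`. -/
def mass (ν : ℝ) : ℝ := 3 / 16 * (1 - ν)

/-- The small parameter as a function of the half-length `L`: `ν = 4 e^{-4L}`, that is,
`L = (1/4) ln (4/ν)`. One has `0 < ν < 1` exactly when `L > (ln 4)/4`. -/
def nuOf (L : ℝ) : ℝ := 4 * Real.exp (-4 * L)

/-- `r` is a positive even solution, vanishing at infinity, of `-m r'' + m r - r³ + r⁵ = 0`
on the real line, with `m = (3/16)(1 - ν)`. -/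
structure IsScalarPulse (ν : ℝ) (r : ℝ → ℝ) : Prop where
  contDiff : ContDiff ℝ 2 r
  pos : ∀ x, 0 < r x
  even : ∀ x, r (-x) = r x
  vanishing : Tendsto r (cocompact ℝ) (𝓝 0)
  ode : ∀ x, -mass ν * deriv (deriv r) x + mass ν * r x - r x ^ 3 + r x ^ 5 = 0

/-- The Sobolev space `H²(ℝ)` of real functions on the line. Every class in `H²(ℝ)` has exactly one
`C¹` representative, and `f` is such a representative precisely when `f` is differentiable, `f'` is
locally absolutely continuous, and `f`, `f'`, `f''` (the last defined almost everywhere) are square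
integrable; the weak derivatives of `f` are then `f'` and `f''`. -/
structure MemH2 (f : ℝ → ℝ) : Prop where
  differentiable : Differentiable ℝ f
  absCont : ∀ a b : ℝ, AbsolutelyContinuousOnInterval (deriv f) a b
  memLp : MemLp f 2 volume
  memLp_deriv : MemLp (deriv f) 2 volume
  memLp_deriv2 : MemLp (deriv (deriv f)) 2 volume

/-- The pair `(θ, q)` solves the second equation: `q ∈ H²(ℝ)` is orthogonal to `r` in `L²(ℝ)`, and
`-m q'' + m q - r² q + r⁴ q = r³ - θ r` in `L²(ℝ)`. -/
structure IsPhaseCorrector (ν : ℝ) (r : ℝ → ℝ) (θ : ℝ) (q : ℝ → ℝ) : Prop where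
  memH2 : MemH2 q
  orthogonal : ∫ x, q x * r x = 0
  eqn : ∀ᵐ x, -mass ν * deriv (deriv q) x + mass ν * q x - r x ^ 2 * q x + r x ^ 4 * q x
    = r x ^ 3 - θ * r x

/-- `σ = ∂r/∂L`, the derivative at fixed `x` of `r(x, 4 e^{-4L})` with respect to `L`. -/
def sigma (r : ℝ → ℝ → ℝ) (L x : ℝ) : ℝ := deriv (fun L' => r (nuOf L') x) L

/-- The function `(r² q + 2 r³ q² - r q² - θ q) σ` of `x`, at `ν = 4 e^{-4L}`. Here `r ν`, `θ ν`,
`q ν` are the pulse, the number and the corrector for the parameter value `ν`. -/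
def integrand (r : ℝ → ℝ → ℝ) (θ : ℝ → ℝ) (q : ℝ → ℝ → ℝ) (L x : ℝ) : ℝ :=
  (r (nuOf L) x ^ 2 * q (nuOf L) x + 2 * r (nuOf L) x ^ 3 * q (nuOf L) x ^ 2
    - r (nuOf L) x * q (nuOf L) x ^ 2 - θ (nuOf L) * q (nuOf L) x) * sigma r L x

/-- The `L²(ℝ)` scalar product `a = (r² q + 2 r³ q² - r q² - θ q, σ)`, as a function of `L`. -/
def aCoeff (r : ℝ → ℝ → ℝ) (θ : ℝ → ℝ) (q : ℝ → ℝ → ℝ) (L : ℝ) : ℝ :=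
  ∫ x, integrand r θ q L x

end QuinticGL

end

noncomputable section

namespace QuinticGL

open Real

/-! Everything is explicit in the half-width `l > 0` given by `cosh (2l) = e^{2L}/2`, that is, `ν =
1/cosh²(2l)`. Put `T = tanh (2l)`, so that `m = (3/16)T²`, and let `b`, `s` be the difference and
the sum of `tanh (x+l)` and `tanh (x-l)`. Then `b' = -bs`, `s' = 2b/T - b²`, `s² = b² + 4 - 4b/T`,
and the pulse is `r² = (3/8)Tb`. It is the only one because the energy integral turns the equation
for `r` into a linear one for `1/r²` (`IsScalarPulse.eq_pulse`).

With `q = rφ` the second equation becomes `-m(r²φ')' = r⁴ - θr²`. It integrates once to `φ' =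
-(2/T)F/b` with the flux `F = B/l - s`, `B' = b`; decay of the flux at both ends fixes `θ = 3/4 -
3T/(8l)`, and orthogonality fixes the additive constant of `φ` (`isPhaseCorrector_corrector`).
Uniqueness is a Wronskian argument (`IsPhaseCorrector.unique`).

Up to an exact derivative, the integrand of `a` equals `(9/64)(cosh(2l)/sinh²(2l)) F² cosh(2x)` plus
`1/sinh²(2l)` times a density whose integral is `O(e^{3l})` (`coefIntegrand_eq`). Integration by
parts reduces `∫ F² cosh(2x)` to elementary integrals and `∫ Fs`. The moment `Y = l∫Fs` satisfies
`Y' = 4 - 16l²/sinh²(2l)` and `Y(0+) = 0`; since `∫₀^∞ 16t²/sinh²(2t) dt = π²/3`, one gets `Y = 4l -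
π²/3 + O(e^{-2l})` (`fluxMoment_eq`).

Hence `a = (9/64)(4 - 2π²/(3l) + π²/(3l²))` up to exponentially small terms, and its `l`-derivative
is `3π²/(32l²) + O(l⁻³)`. Since `dl/dL = 1/T` and `L - 1 ≤ l ≤ L`, the same holds in `L`. The class
`ExpBdd` carries bounds on functions together with their `l`-derivatives, so that the small part may
be differentiated. -/

/-! ### Hyperbolic fronts and their derivatives in `x` and in `l`. -/

theorem hasDerivAt_tanh (x : ℝ) : HasDerivAt tanh (1 - tanh x ^ 2) x := by
  have h := (hasDerivAt_sinh x).div (hasDerivAt_cosh x) (cosh_pos x).ne'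
  have e : tanh = fun y => sinh y / cosh y := funext tanh_eq_sinh_div_cosh
  rw [e]
  convert! h using 1
  have := (cosh_pos x).ne'
  field_simp

theorem hasDerivAt_log_cosh (x : ℝ) : HasDerivAt (fun y => log (cosh y)) (tanh x) x := by
  have h := (hasDerivAt_cosh x).log (cosh_pos x).ne'
  rwa [← tanh_eq_sinh_div_cosh] at h

theorem tanh_sub_tanh (a b : ℝ) :
    tanh a - tanh b = tanh (a - b) * (1 - tanh a * tanh b) := by
  have ha := (cosh_pos a).ne'
  have hb := (cosh_pos b).ne'
  have hab := (cosh_pos (a - b)).ne'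
  rw [cosh_sub] at hab
  simp only [tanh_eq_sinh_div_cosh, sinh_sub, cosh_sub]
  field_simp

/-- The difference of the two front profiles, proportional to the square of the pulse. -/
def bump (l x : ℝ) : ℝ := tanh (x + l) - tanh (x - l)

/-- The sum of the two front profiles. -/
def frontSum (l x : ℝ) : ℝ := tanh (x + l) + tanh (x - l)

/-- The odd primitive of `bump`. -/
def bumpPrim (l x : ℝ) : ℝ := log (cosh (x + l)) - log (cosh (x - l))

/-- The normalized flux of the phase corrector. -/
def flux (l x : ℝ) : ℝ := bumpPrim l x / l - frontSum l x

/-- The flux divided by the squared pulse profile. -/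
def slope (l x : ℝ) : ℝ := flux l x / bump l x

/-- The square root of `1 - ν` in terms of the half-width. -/
def amp (l : ℝ) : ℝ := tanh (2 * l)

theorem amp_pos {l : ℝ} (hl : 0 < l) : 0 < amp l := by
  rw [amp, tanh_eq_sinh_div_cosh]
  exact div_pos (sinh_pos_iff.2 (by linarith)) (cosh_pos _)

theorem amp_lt_one (l : ℝ) : amp l < 1 := tanh_lt_one _

theorem bump_eq_amp_mul (l x : ℝ) :
    bump l x = amp l * (1 - tanh (x + l) * tanh (x - l)) := by
  rw [bump, tanh_sub_tanh, amp]; congr 2; ring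

theorem tanh_mul_tanh {l : ℝ} (hl : 0 < l) (x : ℝ) :
    tanh (x + l) * tanh (x - l) = 1 - bump l x / amp l := by
  have := (amp_pos hl).ne'
  rw [bump_eq_amp_mul]; field_simp; ring

/-- This relation closes the algebra: all derivatives of `bump` and `frontSum`, in `x` and in `l`,
are polynomials in these two functions and `1 / amp l`. -/
theorem frontSum_sq {l : ℝ} (hl : 0 < l) (x : ℝ) :
    frontSum l x ^ 2 = bump l x ^ 2 + 4 - 4 * (bump l x / amp l) := by
  have := tanh_mul_tanh hl x
  have h2 : frontSum l x ^ 2 = bump l x ^ 2 + 4 * (tanh (x + l) * tanh (x - l)) := by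
    rw [frontSum, bump]; ring
  rw [h2, this]; ring

theorem sech_sq_add {l : ℝ} (hl : 0 < l) (x : ℝ) :
    (1 - tanh (x + l) ^ 2) + (1 - tanh (x - l) ^ 2) = 2 * (bump l x / amp l) - bump l x ^ 2 := by
  have := tanh_mul_tanh hl x
  have h2 : (1 - tanh (x + l) ^ 2) + (1 - tanh (x - l) ^ 2)
     = 2 - bump l x ^ 2 - 2 * (tanh (x + l) * tanh (x - l)) := by
    rw [bump]; ring
  rw [h2, this]; ring

theorem hasDerivAt_tanh_add (l x : ℝ) :
    HasDerivAt (fun y => tanh (y + l)) (1 - tanh (x + l) ^ 2) x := by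
  rw [← mul_one (1 - _)]
  exact (hasDerivAt_tanh (x + l)).comp x ((hasDerivAt_id x).add_const l)

theorem hasDerivAt_tanh_sub (l x : ℝ) :
    HasDerivAt (fun y => tanh (y - l)) (1 - tanh (x - l) ^ 2) x := by
  rw [← mul_one (1 - _)]
  exact (hasDerivAt_tanh (x - l)).comp x ((hasDerivAt_id x).sub_const l)

theorem hasDerivAt_tanh_add_param (l x : ℝ) :
    HasDerivAt (fun k => tanh (x + k)) (1 - tanh (x + l) ^ 2) l := by
  rw [← mul_one (1 - _)]
  exact (hasDerivAt_tanh (x + l)).comp l ((hasDerivAt_id l).const_add x)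

theorem hasDerivAt_tanh_sub_param (l x : ℝ) :
    HasDerivAt (fun k => tanh (x - k)) (-(1 - tanh (x - l) ^ 2)) l := by
  rw [← mul_neg_one]
  exact (hasDerivAt_tanh (x - l)).comp l ((hasDerivAt_id l).const_sub x)

theorem hasDerivAt_bump (l x : ℝ) :
    HasDerivAt (bump l) (-(bump l x * frontSum l x)) x := by
  convert! (hasDerivAt_tanh_add l x).sub (hasDerivAt_tanh_sub l x) using 1
  rw [bump, frontSum]; ring

theorem hasDerivAt_frontSum {l : ℝ} (hl : 0 < l) (x : ℝ) :
    HasDerivAt (frontSum l) (2 * (bump l x / amp l) - bump l x ^ 2) x := by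
  rw [← sech_sq_add hl]
  exact (hasDerivAt_tanh_add l x).add (hasDerivAt_tanh_sub l x)

theorem hasDerivAt_bumpPrim (l x : ℝ) : HasDerivAt (bumpPrim l) (bump l x) x := by
  have h1 := (hasDerivAt_log_cosh (x + l)).comp x ((hasDerivAt_id x).add_const l)
  have h2 := (hasDerivAt_log_cosh (x - l)).comp x ((hasDerivAt_id x).sub_const l)
  have := h1.sub h2
  simp only [mul_one] at this
  exact this

theorem hasDerivAt_flux {l : ℝ} (hl : 0 < l) (x : ℝ) :
    HasDerivAt (flux l) (bump l x / l - (2 * (bump l x / amp l) - bump l x ^ 2)) x :=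
  ((hasDerivAt_bumpPrim l x).div_const l).sub (hasDerivAt_frontSum hl x)

/-- The two fronts move in opposite directions, so `∂_l` of the difference is `∂_x` of the sum, and
conversely. -/
theorem hasDerivAt_bump_param {l : ℝ} (hl : 0 < l) (x : ℝ) :
    HasDerivAt (fun k => bump k x) (2 * (bump l x / amp l) - bump l x ^ 2) l := by
  rw [← sech_sq_add hl]
  convert! (hasDerivAt_tanh_add_param l x).sub (hasDerivAt_tanh_sub_param l x) using 1
  ring

theorem hasDerivAt_frontSum_param (l x : ℝ) :
    HasDerivAt (fun k => frontSum k x) (-(bump l x * frontSum l x)) l := by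
  convert! (hasDerivAt_tanh_add_param l x).add (hasDerivAt_tanh_sub_param l x) using 1
  rw [bump, frontSum]; ring

theorem hasDerivAt_bumpPrim_param (l x : ℝ) :
    HasDerivAt (fun k => bumpPrim k x) (frontSum l x) l := by
  have h1 := (hasDerivAt_log_cosh (x + l)).comp l ((hasDerivAt_id l).const_add x)
  have h2 := (hasDerivAt_log_cosh (x - l)).comp l ((hasDerivAt_id l).const_sub x)
  have := h1.sub h2
  simp only [mul_one, mul_neg, sub_neg_eq_add] at this
  exact this

theorem hasDerivAt_flux_param {l : ℝ} (hl : 0 < l) (x : ℝ) :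
    HasDerivAt (fun k => flux k x) (-(flux l x / l) + bump l x * frontSum l x) l := by
  have := ((hasDerivAt_bumpPrim_param l x).div (hasDerivAt_id l) hl.ne').sub
    (hasDerivAt_frontSum_param l x)
  convert! this using 1
  simp only [flux, id]
  field_simp
  ring

theorem bump_eq (l x : ℝ) : bump l x = 2 * sinh (2 * l) / (cosh (2 * x) + cosh (2 * l)) := by
  have h1 := (cosh_pos (x + l)).ne'
  have h2 := (cosh_pos (x - l)).ne'
  have e1 : sinh (2 * l) = sinh (x + l) * cosh (x - l) - cosh (x + l) * sinh (x - l) := by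
    rw [← sinh_sub]; congr 1; ring
  have e2 : cosh (2 * x) + cosh (2 * l) = 2 * (cosh (x + l) * cosh (x - l)) := by
    have a1 : cosh (2 * x) = cosh (x + l) * cosh (x - l) + sinh (x + l) * sinh (x - l) := by
      rw [← cosh_add]; congr 1; ring
    have a2 : cosh (2 * l) = cosh (x + l) * cosh (x - l) - sinh (x + l) * sinh (x - l) := by
      rw [← cosh_sub]; congr 1; ring
    rw [a1, a2]; ring
  rw [e1, e2, bump, tanh_eq_sinh_div_cosh, tanh_eq_sinh_div_cosh]
  field_simp

theorem bump_pos {l : ℝ} (hl : 0 < l) (x : ℝ) : 0 < bump l x := by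
  rw [bump_eq]
  have := sinh_pos_iff.2 (by linarith : 0 < 2 * l)
  have := cosh_pos (2 * x)
  have := cosh_pos (2 * l)
  positivity

theorem abs_bump_le_two (l x : ℝ) : |bump l x| ≤ 2 := by
  have h1 := tanh_lt_one (x + l)
  have h2 := tanh_lt_one (x - l)
  have h3 := neg_one_lt_tanh (x + l)
  have h4 := neg_one_lt_tanh (x - l)
  rw [bump, abs_le]; constructor <;> linarith

theorem abs_frontSum_le_two (l x : ℝ) : |frontSum l x| ≤ 2 := by
  have h1 := tanh_lt_one (x + l)
  have h2 := tanh_lt_one (x - l)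
  have h3 := neg_one_lt_tanh (x + l)
  have h4 := neg_one_lt_tanh (x - l)
  rw [frontSum, abs_le]; constructor <;> linarith

theorem bump_neg (l x : ℝ) : bump l (-x) = bump l x := by
  rw [bump_eq, bump_eq]; simp

theorem frontSum_neg (l x : ℝ) : frontSum l (-x) = -frontSum l x := by
  have e1 : -x + l = -(x - l) := by ring
  have e2 : -x - l = -(x + l) := by ring
  rw [frontSum, frontSum, e1, e2, tanh_neg, tanh_neg]; ring

theorem bumpPrim_neg (l x : ℝ) : bumpPrim l (-x) = -bumpPrim l x := by
  have e1 : -x + l = -(x - l) := by ring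
  have e2 : -x - l = -(x + l) := by ring
  rw [bumpPrim, bumpPrim, e1, e2, cosh_neg, cosh_neg]; ring

theorem flux_neg (l x : ℝ) : flux l (-x) = -flux l x := by
  rw [flux, flux, bumpPrim_neg, frontSum_neg]; ring

theorem bump_abs (l x : ℝ) : bump l (|x|) = bump l x := by
  rcases abs_choice x with h | h <;> rw [h]
  exact bump_neg l x

theorem abs_flux_abs (l x : ℝ) : |flux l (|x|)| = |flux l x| := by
  rcases abs_choice x with h | h <;> rw [h]
  rw [flux_neg, abs_neg]

/-! ### Decay of `bump` and `flux`, and boundedness of their quotient. -/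

/-- On the plateau `|x| ≤ l` the bound 2 is enough; outside it the decay rate is 2. A smaller `k`
trades decay in `x` for a smaller factor `exp (k l)`. -/
theorem bump_le_exp_of_le_two {l k : ℝ} (hl : 0 < l) (hk : 0 ≤ k) (hk2 : k ≤ 2) (x : ℝ) :
    bump l x ≤ 2 * exp (k * (l - |x|)) := by
  rcases le_total |x| l with h | h
  · have h1 := (le_abs_self _).trans (abs_bump_le_two l x)
    have h2 : 1 ≤ exp (k * (l - |x|)) := one_le_exp (mul_nonneg hk (by linarith))
    linarith
  · have h1 : exp (2 * (l - |x|)) ≤ exp (k * (l - |x|)) := by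
      apply exp_le_exp.2; nlinarith
    refine le_trans ?_ (mul_le_mul_of_nonneg_left h1 zero_le_two)
    rw [← bump_abs, bump_eq, div_le_iff₀ (by have := cosh_pos (2 * |x|); have := cosh_pos (2 * l); positivity)]
    have h3 : exp (2 * |x|) ≤ 2 * cosh (2 * |x|) := by
      rw [cosh_eq]; have := exp_pos (-(2 * |x|)); linarith
    have h4 : 2 * sinh (2 * l) ≤ exp (2 * l) := by
      rw [sinh_eq]; have := exp_pos (-(2 * l)); linarith
    have h5 := cosh_pos (2 * l)
    have h6 : exp (2 * (l - |x|)) * exp (2 * |x|) = exp (2 * l) := by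
      rw [← exp_add]; congr 1; ring
    have h7 := exp_pos (2 * (l - |x|))
    nlinarith

theorem one_sub_tanh_nonneg (y : ℝ) : 0 ≤ 1 - tanh y := by linarith [tanh_lt_one y]

theorem one_sub_tanh_le (y : ℝ) : 1 - tanh y ≤ 2 * exp (-2 * y) := by
  have h := exp_pos y
  have h2 := exp_pos (-y)
  have e : exp (-2 * y) = exp (-y) * exp (-y) := by rw [← exp_add]; congr 1; ring
  have e2 : exp y * exp (-y) = 1 := by rw [← exp_add]; simp
  rw [tanh_eq, e, one_sub_div (by positivity), div_le_iff₀ (by positivity)]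
  nlinarith [mul_pos h2 h2, mul_pos (mul_pos h2 h2) h2]

theorem log_cosh_eq (y : ℝ) : log (cosh y) = y - log 2 + log (1 + exp (-2 * y)) := by
  have e : cosh y = exp y / 2 * (1 + exp (-2 * y)) := by
    have e2 : exp y * exp (-2 * y) = exp (-y) := by rw [← exp_add]; congr 1; ring
    rw [cosh_eq]; linear_combination -e2 / 2
  have := exp_pos y
  have := exp_pos (-2 * y)
  rw [e, log_mul (by positivity) (by positivity), log_div (by positivity) two_ne_zero, log_exp]

theorem bumpPrim_le (l x : ℝ) (hl : 0 < l) : bumpPrim l x ≤ 2 * l := by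
  rw [bumpPrim, log_cosh_eq, log_cosh_eq]
  have : log (1 + exp (-2 * (x + l))) ≤ log (1 + exp (-2 * (x - l))) := by
    apply log_le_log (by positivity)
    have : exp (-2 * (x + l)) ≤ exp (-2 * (x - l)) := exp_le_exp.2 (by linarith)
    linarith
  linarith

theorem two_mul_sub_bumpPrim_le (l x : ℝ) : 2 * l - bumpPrim l x ≤ exp (2 * (l - x)) := by
  rw [bumpPrim, log_cosh_eq, log_cosh_eq]
  have h1 : log (1 + exp (-2 * (x - l))) ≤ exp (-2 * (x - l)) := by
    have := log_le_sub_one_of_pos (show 0 < 1 + exp (-2 * (x - l)) by positivity)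
    linarith
  have h2 : 0 ≤ log (1 + exp (-2 * (x + l))) := log_nonneg (by have := exp_pos (-2 * (x + l)); linarith)
  rw [show 2 * (l - x) = -2 * (x - l) by ring]
  linarith

theorem abs_bumpPrim_le {l : ℝ} (hl : 0 < l) (x : ℝ) : |bumpPrim l x| ≤ 2 * l := by
  rw [abs_le]
  have h1 := bumpPrim_le l x hl
  have h2 := bumpPrim_le l (-x) hl
  rw [bumpPrim_neg] at h2
  constructor <;> linarith

theorem abs_flux_le {l : ℝ} (hl : 0 < l) (x : ℝ) : |flux l x| ≤ 4 := by
  have h1 : |bumpPrim l x / l| ≤ 2 := by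
    rw [abs_div, abs_of_pos hl, div_le_iff₀ hl]; exact abs_bumpPrim_le hl x
  have h2 := abs_frontSum_le_two l x
  calc |flux l x| ≤ |bumpPrim l x / l| + |frontSum l x| := abs_sub _ _
    _ ≤ 4 := by linarith

theorem abs_flux_le_exp {l : ℝ} (hl : 0 < l) (x : ℝ) :
    |flux l x| ≤ (4 + 1 / l) * exp (2 * (l - |x|)) := by
  rw [← abs_flux_abs]
  set y := |x|
  have h1 := bumpPrim_le l y hl
  have h2 := two_mul_sub_bumpPrim_le l y
  have h3 := one_sub_tanh_le (y + l)
  have h4 := one_sub_tanh_le (y - l)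
  have h5 := one_sub_tanh_nonneg (y + l)
  have h6 := one_sub_tanh_nonneg (y - l)
  have h7 : exp (-2 * (y + l)) ≤ exp (2 * (l - y)) := exp_le_exp.2 (by linarith)
  have h8 : exp (-2 * (y - l)) = exp (2 * (l - y)) := by congr 1; ring
  -- Both `frontSum` and `bumpPrim / l` tend to 2 at `+∞`, so the flux is a difference of two
  -- deviations from 2, each exponentially small.
  have e : flux l y = ((1 - tanh (y + l)) + (1 - tanh (y - l))) - (2 * l - bumpPrim l y) / l := by
    rw [flux, frontSum]; field_simp; ring
  have h9 : 0 ≤ (2 * l - bumpPrim l y) / l := div_nonneg (by linarith) hl.le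
  have h10 : (2 * l - bumpPrim l y) / l ≤ 1 / l * exp (2 * (l - y)) := by
    rw [div_mul_eq_mul_div, one_mul]; gcongr
  have h11 : 0 < 1 / l * exp (2 * (l - y)) := by positivity
  rw [e, abs_le]
  constructor <;> nlinarith [exp_pos (2 * (l - y))]

theorem exp_le_bump {l : ℝ} (hl : 0 < l) {x : ℝ} (hx : l ≤ |x|) :
    amp l / 2 * exp (2 * (l - |x|)) ≤ bump l x := by
  have hc := cosh_pos (2 * l)
  have hc2 := cosh_pos (2 * |x|)
  rw [← bump_abs, bump_eq, le_div_iff₀ (by positivity), amp, tanh_eq_sinh_div_cosh]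
  have h1 : cosh (2 * l) ≤ cosh (2 * |x|) := by
    rw [cosh_le_cosh, abs_of_pos (by linarith), abs_of_nonneg (by positivity)]; linarith
  have h2 : cosh (2 * |x|) ≤ exp (2 * |x|) := by
    rw [cosh_eq]
    have : exp (-(2 * |x|)) ≤ exp (2 * |x|) := exp_le_exp.2 (by linarith [abs_nonneg x])
    linarith
  have h3 : exp (2 * (l - |x|)) * exp (2 * |x|) = exp (2 * l) := by
    rw [← exp_add]; congr 1; ring
  have h4 : exp (2 * l) ≤ 2 * cosh (2 * l) := by
    rw [cosh_eq]; have := exp_pos (-(2 * l)); linarith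
  have hs := sinh_pos_iff.2 (by linarith : 0 < 2 * l)
  have h5 : exp (2 * (l - |x|)) * (cosh (2 * |x|) + cosh (2 * l)) ≤ 4 * cosh (2 * l) := by
    have := exp_pos (2 * (l - |x|))
    nlinarith
  calc _ = sinh (2 * l) / cosh (2 * l) / 2 * (exp (2 * (l - |x|)) * (cosh (2 * |x|) + cosh (2 * l))) := by ring
    _ ≤ sinh (2 * l) / cosh (2 * l) / 2 * (4 * cosh (2 * l)) := by gcongr
    _ = _ := by field_simp; ring

theorem amp_le_bump {l : ℝ} (hl : 0 < l) {x : ℝ} (hx : |x| ≤ l) : amp l ≤ bump l x := by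
  have hc := cosh_pos (2 * l)
  have hc2 := cosh_pos (2 * |x|)
  rw [← bump_abs, bump_eq, amp, tanh_eq_sinh_div_cosh, div_le_div_iff₀ hc (by positivity)]
  have h1 : cosh (2 * |x|) ≤ cosh (2 * l) := by
    rw [cosh_le_cosh, abs_of_pos (by linarith : 0 < 2 * l), abs_of_nonneg (by positivity)]; linarith
  have hs := sinh_pos_iff.2 (by linarith : 0 < 2 * l)
  nlinarith

/-- On the plateau `bump` is at least `amp l` and the flux is bounded; outside, flux and `bump`
decay at the same rate. Hence the phase will grow at most linearly in `x`. -/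
theorem abs_slope_le {l : ℝ} (hl : 0 < l) (x : ℝ) : |slope l x| ≤ (8 + 2 / l) / amp l := by
  have hT := amp_pos hl
  have hd := bump_pos hl x
  rw [slope, abs_div, abs_of_pos hd, div_le_div_iff₀ hd hT]
  have hl' : 0 < 1 / l := by positivity
  have e : (8 + 2 / l) = 2 * (4 + 1 / l) := by ring
  rw [e]
  rcases le_total |x| l with h | h
  · have h1 := abs_flux_le hl x
    have h2 := amp_le_bump hl h
    nlinarith [abs_nonneg (flux l x)]
  · have h1 := abs_flux_le_exp hl x
    have h2 := exp_le_bump hl h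
    have h3 := mul_le_mul_of_nonneg_right h1 hT.le
    nlinarith

theorem hasDerivAt_slope {l : ℝ} (hl : 0 < l) (x : ℝ) :
    HasDerivAt (slope l) (1 / l - 2 / amp l + bump l x + slope l x * frontSum l x) x := by
  have hd := (bump_pos hl x).ne'
  have hT := (amp_pos hl).ne'
  convert! (hasDerivAt_flux hl x).div (hasDerivAt_bump l x) hd using 1
  rw [slope]
  field_simp
  ring

theorem hasDerivAt_slope_param {l : ℝ} (hl : 0 < l) (x : ℝ) :
    HasDerivAt (fun k => slope k x)
      (-(slope l x / l) + frontSum l x - slope l x * (2 / amp l - bump l x)) l := by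
  have hd := (bump_pos hl x).ne'
  have hT := (amp_pos hl).ne'
  convert! (hasDerivAt_flux_param hl x).div (hasDerivAt_bump_param hl x) hd using 1
  rw [slope]
  field_simp

theorem flux_eq {l : ℝ} (hl : 0 < l) (x : ℝ) : flux l x = slope l x * bump l x := by
  rw [slope, div_mul_cancel₀ _ (bump_pos hl x).ne']

theorem hasDerivAt_amp (l : ℝ) : HasDerivAt amp (2 * (1 - amp l ^ 2)) l := by
  have := (hasDerivAt_tanh (2 * l)).comp l ((hasDerivAt_id l).const_mul 2)
  convert! this using 1
  simp [amp]; ring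

theorem continuous_tanh : Continuous tanh :=
  continuous_iff_continuousAt.2 fun x => (hasDerivAt_tanh x).continuousAt

theorem continuous_bump (l : ℝ) : Continuous (bump l) :=
  continuous_iff_continuousAt.2 fun x => (hasDerivAt_bump l x).continuousAt

theorem continuous_frontSum (l : ℝ) : Continuous (frontSum l) := by
  unfold frontSum
  exact (continuous_tanh.comp (continuous_id.add_const l)).add
    (continuous_tanh.comp (continuous_id.sub continuous_const))

theorem continuous_slope {l : ℝ} (hl : 0 < l) : Continuous (slope l) :=
  continuous_iff_continuousAt.2 fun x => (hasDerivAt_slope hl x).continuousAt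

theorem amp_sq (l : ℝ) : amp l ^ 2 = 1 - 1 / cosh (2 * l) ^ 2 := by
  have := (cosh_pos (2 * l)).ne'
  rw [amp, tanh_eq_sinh_div_cosh, div_pow, sinh_sq]
  field_simp

theorem tendsto_tanh_atTop : Tendsto tanh atTop (𝓝 1) := by
  have h : Tendsto (fun y : ℝ => 1 - 2 * exp (-2 * y)) atTop (𝓝 (1 - 2 * 0)) := by
    refine (Tendsto.const_mul 2 ?_).const_sub 1
    exact tendsto_exp_atBot.comp (tendsto_id.const_mul_atTop_of_neg (by norm_num))
  simp only [mul_zero, sub_zero] at h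
  exact tendsto_of_tendsto_of_tendsto_of_le_of_le h tendsto_const_nhds
    (fun y => by linarith [one_sub_tanh_le y]) (fun y => (tanh_lt_one y).le)

theorem tendsto_frontSum_atTop (l : ℝ) : Tendsto (frontSum l) atTop (𝓝 2) := by
  have h1 := tendsto_tanh_atTop.comp (tendsto_atTop_add_const_right atTop l tendsto_id)
  have h2 := tendsto_tanh_atTop.comp (tendsto_atTop_add_const_right atTop (-l) tendsto_id)
  have := h1.add h2
  norm_num at this
  exact this

theorem tendsto_bumpPrim_atTop {l : ℝ} (hl : 0 < l) : Tendsto (bumpPrim l) atTop (𝓝 (2 * l)) := by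
  have h : Tendsto (fun x : ℝ => 2 * l - exp (2 * (l - x))) atTop (𝓝 (2 * l - 0)) := by
    refine Tendsto.const_sub _ (tendsto_exp_atBot.comp ?_)
    refine Tendsto.const_mul_atBot two_pos ?_
    exact tendsto_atBot_add_const_left _ l tendsto_neg_atTop_atBot
  rw [sub_zero] at h
  exact tendsto_of_tendsto_of_tendsto_of_le_of_le h tendsto_const_nhds
    (fun y => by linarith [two_mul_sub_bumpPrim_le l y]) (fun y => bumpPrim_le l y hl)

theorem tendsto_atBot_of_odd {f : ℝ → ℝ} {c : ℝ} (hf : ∀ x, f (-x) = -f x)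
    (h : Tendsto f atTop (𝓝 c)) : Tendsto f atBot (𝓝 (-c)) := by
  have := (h.comp tendsto_neg_atBot_atTop).neg
  refine this.congr fun x => ?_
  simp [hf]

/-! ### The explicit pulse. -/

/-- The explicit pulse of half-width `l`. -/
def pulse (l x : ℝ) : ℝ := √(3 / 8 * amp l * bump l x)

theorem pulse_sq {l : ℝ} (hl : 0 < l) (x : ℝ) : pulse l x ^ 2 = 3 / 8 * amp l * bump l x := by
  have := amp_pos hl
  have := bump_pos hl x
  rw [pulse, sq_sqrt (by positivity)]

theorem pulse_pos {l : ℝ} (hl : 0 < l) (x : ℝ) : 0 < pulse l x := by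
  have := amp_pos hl
  have := bump_pos hl x
  exact sqrt_pos.2 (by positivity)

theorem hasDerivAt_pulse {l : ℝ} (hl : 0 < l) (x : ℝ) :
    HasDerivAt (pulse l) (-(pulse l x * frontSum l x / 2)) x := by
  have hT := amp_pos hl
  have hd := bump_pos hl x
  have hp := (pulse_pos hl x).ne'
  have h := ((hasDerivAt_bump l x).const_mul (3 / 8 * amp l)).sqrt (by positivity)
  convert! h using 1
  change _ = _ / (2 * pulse l x)
  have := pulse_sq hl x
  field_simp
  rw [this]; ring

theorem hasDerivAt_pulse_deriv {l : ℝ} (hl : 0 < l) (x : ℝ) :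
    HasDerivAt (fun y => -(pulse l y * frontSum l y / 2))
      (pulse l x * (frontSum l x ^ 2 / 4 - (2 * (bump l x / amp l) - bump l x ^ 2) / 2)) x := by
  convert! (((hasDerivAt_pulse hl x).mul (hasDerivAt_frontSum hl x)).div_const 2).neg using 1
  ring

theorem hasDerivAt_pulse_param {l : ℝ} (hl : 0 < l) (x : ℝ) :
    HasDerivAt (fun k => pulse k x)
      (pulse l x * (4 / amp l - 2 * amp l - bump l x) / 2) l := by
  have hT := amp_pos hl
  have hd := bump_pos hl x
  have hp := (pulse_pos hl x).ne'
  have h := (((hasDerivAt_amp l).const_mul (3 / 8)).mul (hasDerivAt_bump_param hl x)).sqrt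
    (by simp only [Pi.mul_apply]; positivity)
  convert! h using 1
  change _ = _ / (2 * pulse l x)
  have := pulse_sq hl x
  field_simp
  rw [this]; field_simp; ring

theorem continuous_pulse {l : ℝ} (hl : 0 < l) : Continuous (pulse l) :=
  continuous_iff_continuousAt.2 fun x => (hasDerivAt_pulse hl x).continuousAt

theorem pulse_neg (l x : ℝ) : pulse l (-x) = pulse l x := by
  rw [pulse, pulse, bump_neg]

theorem contDiff_two_of_hasDerivAt {f f' f'' : ℝ → ℝ} (h : ∀ x, HasDerivAt f (f' x) x)
    (h' : ∀ x, HasDerivAt f' (f'' x) x) (hc : Continuous f'') : ContDiff ℝ 2 f := by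
  have e : deriv f = f' := funext fun x => (h x).deriv
  have e' : deriv f' = f'' := funext fun x => (h' x).deriv
  have h1 : ContDiff ℝ 1 f' :=
    contDiff_one_iff_deriv.2 ⟨fun x => (h' x).differentiableAt, by rwa [e']⟩
  rw [show (2 : WithTop ℕ∞) = 1 + 1 by norm_num, contDiff_succ_iff_deriv]
  exact ⟨fun x => (h x).differentiableAt, by simp, by rwa [e]⟩

theorem tendsto_exp_mul_sub_abs (l : ℝ) {k : ℝ} (hk : 0 < k) :
    Tendsto (fun x : ℝ => exp (k * (l - |x|))) (cocompact ℝ) (𝓝 0) := by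
  refine tendsto_exp_atBot.comp (Tendsto.const_mul_atBot hk ?_)
  refine tendsto_atBot_add_const_left _ l (tendsto_neg_atTop_atBot.comp ?_)
  exact tendsto_norm_cocompact_atTop

theorem tendsto_bump_cocompact {l : ℝ} (hl : 0 < l) : Tendsto (bump l) (cocompact ℝ) (𝓝 0) := by
  refine squeeze_zero (fun x => (bump_pos hl x).le)
    (fun x => bump_le_exp_of_le_two hl zero_le_two le_rfl x) ?_
  simpa using (tendsto_exp_mul_sub_abs l two_pos).const_mul 2

theorem tendsto_pulse_cocompact {l : ℝ} (hl : 0 < l) : Tendsto (pulse l) (cocompact ℝ) (𝓝 0) := by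
  have := ((tendsto_bump_cocompact hl).const_mul (3 / 8 * amp l)).sqrt
  rwa [mul_zero, sqrt_zero] at this

/-- This is `m r''/r = m - r² + r⁴`. It removes the zeroth-order term wherever a function is
compared with `r`: in the corrector equation and in the Wronskian. -/
theorem pulse_mass_eq {l : ℝ} (hl : 0 < l) (x : ℝ) :
    3 / 16 * amp l ^ 2 * (frontSum l x ^ 2 / 4 - (2 * (bump l x / amp l) - bump l x ^ 2) / 2)
      = 3 / 16 * amp l ^ 2 - pulse l x ^ 2 + pulse l x ^ 4 := by
  have hT := (amp_pos hl).ne'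
  rw [show pulse l x ^ 4 = (pulse l x ^ 2) ^ 2 by ring, pulse_sq hl, frontSum_sq hl]
  field_simp
  ring

theorem isScalarPulse_pulse {ν l : ℝ} (hl : 0 < l) (hν : mass ν = 3 / 16 * amp l ^ 2) :
    IsScalarPulse ν (pulse l) where
  contDiff := by
    refine contDiff_two_of_hasDerivAt (hasDerivAt_pulse hl) (hasDerivAt_pulse_deriv hl) ?_
    have h1 := continuous_pulse hl
    have h2 := continuous_bump l
    have h3 := continuous_frontSum l
    fun_prop
  pos := pulse_pos hl
  even := pulse_neg l
  vanishing := tendsto_pulse_cocompact hl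
  ode x := by
    rw [show deriv (pulse l) = fun y => -(pulse l y * frontSum l y / 2) from
      funext fun y => (hasDerivAt_pulse hl y).deriv, (hasDerivAt_pulse_deriv hl x).deriv, hν]
    linear_combination -(pulse l x) * pulse_mass_eq hl x

/-! ### Uniqueness of the pulse. -/

theorem is_const_of_hasDerivAt_zero {f : ℝ → ℝ} (h : ∀ x, HasDerivAt f 0 x) (x y : ℝ) :
    f x = f y :=
  is_const_of_deriv_eq_zero (fun x => (h x).differentiableAt) (fun x => (h x).deriv) x y

/-- The operator factors, so `e^{-2x}(v' + 2v)` and `e^{2x}(v' - 2v)` are constant. -/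
theorem eq_mul_cosh_of_deriv_eq {v v' : ℝ → ℝ} (h : ∀ x, HasDerivAt v (v' x) x)
    (h' : ∀ x, HasDerivAt v' (4 * v x) x) (h0 : v' 0 = 0) (x : ℝ) :
    v x = v 0 * cosh (2 * x) := by
  have hm (c y : ℝ) : HasDerivAt (fun x : ℝ => exp (c * x)) (exp (c * y) * c) y := by
    simpa using ((hasDerivAt_id y).const_mul c).exp
  have h1 := is_const_of_hasDerivAt_zero (f := fun x => exp (-2 * x) * (v' x + 2 * v x))
    (fun y => by
      convert! (hm (-2) y).mul ((h' y).add ((h y).const_mul 2)) using 1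
      simp only [Pi.add_apply]
      ring) x 0
  have h2 := is_const_of_hasDerivAt_zero (f := fun x => exp (2 * x) * (v' x - 2 * v x))
    (fun y => by
      convert! (hm 2 y).mul ((h' y).sub ((h y).const_mul 2)) using 1
      simp only [Pi.sub_apply]
      ring) x 0
  simp only [h0, mul_zero, exp_zero] at h1 h2
  have e : exp (2 * x) * exp (-2 * x) = 1 := by rw [← exp_add]; simp
  rw [cosh_eq, ← neg_mul]
  linear_combination (exp (2 * x) / 4) * h1 - (exp (-2 * x) / 4) * h2 - v x * e

/-- Mean value theorem on `[n, n+1]`. A sequence is enough to evaluate a conserved energy at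
infinity. -/
theorem exists_deriv_tendsto_zero {f f' : ℝ → ℝ} (h : ∀ x, HasDerivAt f (f' x) x)
    (hf : Tendsto f atTop (𝓝 0)) :
    ∃ ξ : ℕ → ℝ, Tendsto ξ atTop atTop ∧ Tendsto (fun n => f' (ξ n)) atTop (𝓝 0) := by
  have key (n : ℕ) : ∃ c ∈ Set.Ioo (n : ℝ) (n + 1), f' c = f (n + 1) - f n := by
    obtain ⟨c, hc, e⟩ := exists_hasDerivAt_eq_slope f f' (lt_add_one (n : ℝ))
      (fun x _ => (h x).continuousAt.continuousWithinAt) (fun x _ => h x)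
    exact ⟨c, hc, by rw [e]; simp⟩
  choose ξ hξ e using key
  refine ⟨ξ, tendsto_atTop_mono (fun n => (hξ n).1.le) tendsto_natCast_atTop_atTop, ?_⟩
  simp only [e]
  have h1 := hf.comp (tendsto_natCast_atTop_atTop (R := ℝ))
  have h2 := hf.comp (tendsto_atTop_add_const_right atTop (1 : ℝ)
    (tendsto_natCast_atTop_atTop (R := ℝ)))
  simpa using h2.sub h1

theorem IsScalarPulse.eq_pulse {ν l : ℝ} {r : ℝ → ℝ} (hl : 0 < l)
    (hν : ν = 1 / cosh (2 * l) ^ 2) (hr : IsScalarPulse ν r) : r = pulse l := by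
  have hc := cosh_pos (2 * l)
  have hs := sinh_pos_iff.2 (by linarith : 0 < 2 * l)
  have hT := amp_pos hl
  have hm : mass ν = 3 / 16 * amp l ^ 2 := by rw [mass, hν, amp_sq]
  set m := mass ν with hmdef
  have hm0 : 0 < m := by rw [hm]; positivity
  have hr1 : ContDiff ℝ 1 (deriv r) := by
    have := hr.contDiff
    rw [show (2 : WithTop ℕ∞) = 1 + 1 by norm_num, contDiff_succ_iff_deriv] at this
    exact this.2.2
  have d1 (x : ℝ) : HasDerivAt r (deriv r x) x :=
    (hr.contDiff.differentiable (by norm_num) x).hasDerivAt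
  have d2 (x : ℝ) : HasDerivAt (deriv r) (deriv (deriv r) x) x :=
    (hr1.differentiable (by norm_num) x).hasDerivAt
  have ode (x : ℝ) : m * deriv (deriv r) x = m * r x - r x ^ 3 + r x ^ 5 := by
    linear_combination -hr.ode x
  -- Energy integral; its constant is zero because `r`, and `r'` along a sequence, tend to zero.
  have hE (x : ℝ) : m * deriv r x ^ 2 = m * r x ^ 2 - r x ^ 4 / 2 + r x ^ 6 / 3 := by
    have hconst := is_const_of_hasDerivAt_zero
      (f := fun x => m * deriv r x ^ 2 - (m * r x ^ 2 - r x ^ 4 / 2 + r x ^ 6 / 3))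
      (fun y => by
        convert! (((d2 y).pow 2).const_mul m).sub (((((d1 y).pow 2).const_mul m).sub
          (((d1 y).pow 4).div_const 2)).add (((d1 y).pow 6).div_const 3)) using 1
        push_cast
        linear_combination -2 * deriv r y * ode y)
    have h0 : Tendsto r atTop (𝓝 0) := hr.vanishing.mono_left atTop_le_cocompact
    obtain ⟨ξ, hξ, hξ'⟩ := exists_deriv_tendsto_zero d1 h0
    have hl0 := h0.comp hξ
    have lim : Tendsto (fun n => m * deriv r (ξ n) ^ 2 -
        (m * r (ξ n) ^ 2 - r (ξ n) ^ 4 / 2 + r (ξ n) ^ 6 / 3)) atTop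
        (𝓝 (m * 0 ^ 2 - (m * 0 ^ 2 - 0 ^ 4 / 2 + 0 ^ 6 / 3))) :=
      ((hξ'.pow 2).const_mul m).sub ((((hl0.pow 2).const_mul m).sub
        ((hl0.pow 4).div_const 2)).add ((hl0.pow 6).div_const 3))
    have hcst : (fun n => m * deriv r (ξ n) ^ 2 -
        (m * r (ξ n) ^ 2 - r (ξ n) ^ 4 / 2 + r (ξ n) ^ 6 / 3)) = fun _ =>
        m * deriv r x ^ 2 - (m * r x ^ 2 - r x ^ 4 / 2 + r x ^ 6 / 3) :=
      funext fun n => hconst (ξ n) x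
    rw [hcst] at lim
    have := tendsto_nhds_unique tendsto_const_nhds lim
    norm_num at this
    linarith
  have r0 (x : ℝ) : r x ≠ 0 := (hr.pos x).ne'
  have hr0 : deriv r 0 = 0 := by
    have h := (d1 (-0)).comp (0 : ℝ) (hasDerivAt_neg 0)
    have e : r ∘ Neg.neg = r := funext hr.even
    rw [e, neg_zero] at h
    have := h.unique (d1 0)
    linarith
  -- Eliminating `r'²` by the energy, `v = 1/r² - 1/(4m)` satisfies the linear equation `v'' = 4v`.
  have w1 (x : ℝ) : HasDerivAt (fun y => (r y ^ 2)⁻¹ - 1 / (4 * m))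
      (-(2 * deriv r x) / r x ^ 3) x := by
    have := r0 x
    convert! (((d1 x).pow 2).inv (pow_ne_zero 2 (r0 x))).sub_const (1 / (4 * m)) using 1
    simp only [Pi.pow_apply]
    field_simp
    simp [mul_comm]
  have w2 (x : ℝ) : HasDerivAt (fun y => -(2 * deriv r y) / r y ^ 3)
      (4 * ((r x ^ 2)⁻¹ - 1 / (4 * m))) x := by
    have := r0 x
    convert! (((d2 x).const_mul 2).neg).div ((d1 x).pow 3) (pow_ne_zero 3 (r0 x)) using 1
    simp only [Pi.pow_apply, Pi.neg_apply]
    field_simp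
    push_cast
    linear_combination 2 * r x ^ 3 * ode x - 6 * r x ^ 2 * hE x
  have hv (x : ℝ) := eq_mul_cosh_of_deriv_eq w1 w2 (by simp [hr0]) x
  set A := (r 0 ^ 2)⁻¹ - 1 / (4 * m) with hA
  -- At the origin `r' = 0`, so the energy gives a quadratic equation for `r(0)²`; it determines `A`
  -- only up to sign.
  have hA2 : A ^ 2 = (1 / (4 * m * cosh (2 * l))) ^ 2 := by
    have h0 := hE 0
    have := r0 0
    rw [hr0] at h0
    have hm' : m = 3 / 16 * (1 - 1 / cosh (2 * l) ^ 2) := by rw [hmdef, mass, hν]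
    have e : 1 / cosh (2 * l) ^ 2 = 1 - 16 * m / 3 := by rw [hm']; ring
    have e2 : (1 / (4 * m * cosh (2 * l))) ^ 2 = (1 - 16 * m / 3) / (16 * m ^ 2) := by
      rw [← e]; field_simp; norm_num
    rw [e2, hA]
    have h1 : m - r 0 ^ 2 / 2 + r 0 ^ 4 / 3 = 0 := by
      have : r 0 ^ 2 * (m - r 0 ^ 2 / 2 + r 0 ^ 4 / 3) = 0 := by linear_combination -h0
      exact (mul_eq_zero.1 this).resolve_left (pow_ne_zero 2 (r0 0))
    field_simp
    linear_combination 768 * m * h1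
  -- The other sign would keep `r² ≥ 4m` everywhere, against the decay of `r`.
  have hApos : 0 < A := by
    by_contra hneg
    push Not at hneg
    have hb (x : ℝ) : 4 * m ≤ r x ^ 2 := by
      have h1 := hv x
      have h2 : A * cosh (2 * x) ≤ 0 := mul_nonpos_of_nonpos_of_nonneg hneg (cosh_pos _).le
      have h3 : (r x ^ 2)⁻¹ ≤ (4 * m)⁻¹ := by rw [← one_div (4 * m)]; linarith
      exact (inv_le_inv₀ (pow_pos (hr.pos x) 2) (by positivity)).1 h3
    have := ge_of_tendsto' (hr.vanishing.pow 2) hb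
    norm_num at this
    linarith
  have hA' : A = 1 / (4 * m * cosh (2 * l)) :=
    (pow_left_inj₀ hApos.le (by positivity) two_ne_zero).1 hA2
  funext x
  have hx := hv x
  rw [hA'] at hx
  have hc2 := cosh_pos (2 * x)
  rw [pulse, eq_comm, sqrt_eq_iff_eq_sq (by have := bump_pos hl x; positivity) (hr.pos x).le,
    bump_eq]
  have e : (r x ^ 2)⁻¹ = (cosh (2 * l) + cosh (2 * x)) / (4 * m * cosh (2 * l)) := by
    have : (r x ^ 2)⁻¹ = 1 / (4 * m) + 1 / (4 * m * cosh (2 * l)) * cosh (2 * x) := by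
      linear_combination hx
    rw [this]; field_simp
  rw [← inv_inv (r x ^ 2), e, inv_div, hm, amp, tanh_eq_sinh_div_cosh]
  field_simp
  ring

/-! ### Exponential bounds uniform in the parameter. -/

theorem integrable_exp_mul_abs {k : ℝ} (hk : k < 0) : Integrable (fun x : ℝ => exp (k * |x|)) := by
  rw [← integrableOn_univ, ← Set.Iic_union_Ioi (a := (0 : ℝ))]
  refine IntegrableOn.union ?_ ?_
  · refine (integrableOn_exp_mul_Iic (neg_pos.2 hk) 0).congr_fun (fun x hx => ?_) measurableSet_Iic
    simp [abs_of_nonpos (show x ≤ 0 from hx)]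
  · refine (integrableOn_exp_mul_Ioi hk 0).congr_fun (fun x hx => ?_) measurableSet_Ioi
    simp [abs_of_pos (show 0 < x from hx)]

theorem integrable_of_abs_le_exp {f : ℝ → ℝ} {C k : ℝ} (hk : k < 0) (hf : Continuous f)
    (h : ∀ x, |f x| ≤ C * exp (k * |x|)) : Integrable f :=
  ((integrable_exp_mul_abs hk).const_mul C).mono' hf.aestronglyMeasurable (.of_forall h)

theorem abs_integral_le_of_abs_le_exp {f : ℝ → ℝ} {C k : ℝ} (hk : k < 0)
    (h : ∀ x, |f x| ≤ C * exp (k * |x|)) :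
    |∫ x, f x| ≤ C * ∫ x : ℝ, exp (k * |x|) := by
  rw [← integral_const_mul]
  exact norm_integral_le_of_norm_le (f := f) ((integrable_exp_mul_abs hk).const_mul C)
    (.of_forall h)

theorem abs_primitive_le_of_abs_le_exp {f : ℝ → ℝ} {C k : ℝ} (hk : 0 < k) (hC : 0 ≤ C)
    (h : ∀ x, |f x| ≤ C * exp (k * |x|)) (x : ℝ) :
    |∫ t in 0..x, f t| ≤ C / k * exp (k * |x|) := by
  have pos (f : ℝ → ℝ) (h : ∀ x, |f x| ≤ C * exp (k * |x|)) (x : ℝ) (hx : 0 ≤ x) :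
      |∫ t in 0..x, f t| ≤ C / k * exp (k * |x|) := by
    have hd (t : ℝ) : HasDerivAt (fun t => C / k * exp (k * t)) (C * exp (k * t)) t := by
      convert! (((hasDerivAt_id t).const_mul k).exp).const_mul (C / k) using 1
      simp only [id]; field_simp
    have hc : Continuous fun t => C * exp (k * t) := by fun_prop
    have h1 := intervalIntegral.norm_integral_le_of_norm_le (μ := volume) (f := f)
      (g := fun t => C * exp (k * t)) hx (.of_forall fun t ht => by
        simpa [abs_of_pos ht.1] using h t) (hc.intervalIntegrable _ _)
    rw [intervalIntegral.integral_eq_sub_of_hasDerivAt (fun t _ => hd t)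
      (hc.intervalIntegrable _ _)] at h1
    have : 0 ≤ C / k * exp (k * 0) := by positivity
    rw [abs_of_nonneg hx]
    rw [Real.norm_eq_abs] at h1
    linarith
  rcases le_total 0 x with hx | hx
  · exact pos f h x hx
  · have := pos (fun t => f (-t)) (fun t => by simpa using h (-t)) (-x) (by linarith)
    rw [intervalIntegral.integral_comp_neg] at this
    rwa [neg_zero, neg_neg, intervalIntegral.integral_symm, abs_neg, abs_neg] at this

/-- Continuous functions of `x`, differentiable in the parameter `l > 0`, bounded together with
their parameter derivative by a multiple of `exp (a l + k |x|)`, uniformly for `l ≥ ε`. -/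
structure ExpBdd (a k : ℝ) (f f' : ℝ → ℝ → ℝ) : Prop where
  deriv : ∀ l, 0 < l → ∀ x, HasDerivAt (fun l => f l x) (f' l x) l
  cont : ∀ l, 0 < l → Continuous (f l)
  cont' : ∀ l, 0 < l → Continuous (f' l)
  bound : ∀ ε, 0 < ε → ∃ C, 0 ≤ C ∧ ∀ l, ε ≤ l → ∀ x,
    |f l x| ≤ C * exp (a * l + k * |x|) ∧ |f' l x| ≤ C * exp (a * l + k * |x|)

namespace ExpBdd

variable {a a₁ a₂ k k₁ k₂ : ℝ} {f f' g g' : ℝ → ℝ → ℝ}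

theorem congr (h : ExpBdd a k f f') (hf : ∀ l, 0 < l → ∀ x, g l x = f l x)
    (hf' : ∀ l, 0 < l → ∀ x, g' l x = f' l x) : ExpBdd a k g g' where
  deriv l hl x := by
    rw [hf' l hl]
    refine (h.deriv l hl x).congr_of_eventuallyEq ?_
    filter_upwards [lt_mem_nhds hl] with y hy using hf y hy x
  cont l hl := by rw [funext (hf l hl)]; exact h.cont l hl
  cont' l hl := by rw [funext (hf' l hl)]; exact h.cont' l hl
  bound ε hε := by
    obtain ⟨C, hC, H⟩ := h.bound ε hε
    refine ⟨C, hC, fun l hl x => ?_⟩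
    rw [hf l (hε.trans_le hl), hf' l (hε.trans_le hl)]
    exact H l hl x

theorem mono (h : ExpBdd a₁ k₁ f f') (ha : a₁ ≤ a₂) (hk : k₁ ≤ k₂) : ExpBdd a₂ k₂ f f' where
  deriv := h.deriv
  cont := h.cont
  cont' := h.cont'
  bound ε hε := by
    obtain ⟨C, hC, H⟩ := h.bound ε hε
    refine ⟨C, hC, fun l hl x => ?_⟩
    have : C * exp (a₁ * l + k₁ * |x|) ≤ C * exp (a₂ * l + k₂ * |x|) := by
      have := hε.trans_le hl
      gcongr
    exact ⟨(H l hl x).1.trans this, (H l hl x).2.trans this⟩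

theorem add (hf : ExpBdd a k f f') (hg : ExpBdd a k g g') :
    ExpBdd a k (fun l x => f l x + g l x) (fun l x => f' l x + g' l x) where
  deriv l hl x := (hf.deriv l hl x).add (hg.deriv l hl x)
  cont l hl := (hf.cont l hl).add (hg.cont l hl)
  cont' l hl := (hf.cont' l hl).add (hg.cont' l hl)
  bound ε hε := by
    obtain ⟨C, hC, H⟩ := hf.bound ε hε
    obtain ⟨D, hD, K⟩ := hg.bound ε hε
    refine ⟨C + D, by positivity, fun l hl x => ?_⟩
    rw [add_mul]
    exact ⟨(abs_add_le _ _).trans (add_le_add (H l hl x).1 (K l hl x).1),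
      (abs_add_le _ _).trans (add_le_add (H l hl x).2 (K l hl x).2)⟩

theorem const_mul (hf : ExpBdd a k f f') (c : ℝ) :
    ExpBdd a k (fun l x => c * f l x) (fun l x => c * f' l x) where
  deriv l hl x := (hf.deriv l hl x).const_mul c
  cont l hl := (hf.cont l hl).const_mul c
  cont' l hl := (hf.cont' l hl).const_mul c
  bound ε hε := by
    obtain ⟨C, hC, H⟩ := hf.bound ε hε
    refine ⟨|c| * C, by positivity, fun l hl x => ?_⟩
    rw [abs_mul, abs_mul, mul_assoc]
    exact ⟨mul_le_mul_of_nonneg_left (H l hl x).1 (abs_nonneg c),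
      mul_le_mul_of_nonneg_left (H l hl x).2 (abs_nonneg c)⟩

theorem neg (hf : ExpBdd a k f f') : ExpBdd a k (fun l x => -f l x) (fun l x => -f' l x) :=
  (hf.const_mul (-1)).congr (fun _ _ _ => by ring) (fun _ _ _ => by ring)

theorem sub (hf : ExpBdd a k f f') (hg : ExpBdd a k g g') :
    ExpBdd a k (fun l x => f l x - g l x) (fun l x => f' l x - g' l x) :=
  (hf.add hg.neg).congr (fun _ _ _ => by ring) (fun _ _ _ => by ring)

theorem mul (hf : ExpBdd a₁ k₁ f f') (hg : ExpBdd a₂ k₂ g g') :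
    ExpBdd (a₁ + a₂) (k₁ + k₂) (fun l x => f l x * g l x)
      (fun l x => f' l x * g l x + f l x * g' l x) where
  deriv l hl x := (hf.deriv l hl x).mul (hg.deriv l hl x)
  cont l hl := (hf.cont l hl).mul (hg.cont l hl)
  cont' l hl := ((hf.cont' l hl).mul (hg.cont l hl)).add ((hf.cont l hl).mul (hg.cont' l hl))
  bound ε hε := by
    obtain ⟨C, hC, H⟩ := hf.bound ε hε
    obtain ⟨D, hD, K⟩ := hg.bound ε hε
    refine ⟨2 * (C * D), by positivity, fun l hl x => ?_⟩
    have e : exp ((a₁ + a₂) * l + (k₁ + k₂) * |x|)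
        = exp (a₁ * l + k₁ * |x|) * exp (a₂ * l + k₂ * |x|) := by
      rw [← exp_add]; congr 1; ring
    have key {u v : ℝ} (hu : |u| ≤ C * exp (a₁ * l + k₁ * |x|))
        (hv : |v| ≤ D * exp (a₂ * l + k₂ * |x|)) :
        |u * v| ≤ C * D * exp ((a₁ + a₂) * l + (k₁ + k₂) * |x|) := by
      rw [abs_mul, e, mul_mul_mul_comm]
      gcongr
    have h0 : 0 ≤ C * D * exp ((a₁ + a₂) * l + (k₁ + k₂) * |x|) := by positivity
    have h1 := key (H l hl x).1 (K l hl x).1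
    have h2 := key (H l hl x).2 (K l hl x).1
    have h3 := key (H l hl x).1 (K l hl x).2
    refine ⟨by linarith, (abs_add_le _ _).trans (by linarith)⟩

theorem pow_two (hf : ExpBdd a k f f') :
    ExpBdd (2 * a) (2 * k) (fun l x => f l x ^ 2) (fun l x => 2 * f l x * f' l x) := by
  rw [two_mul, two_mul]
  exact (hf.mul hf).congr (fun _ _ _ => by ring) (fun _ _ _ => by ring)

theorem integrable (hf : ExpBdd a k f f') (hk : k < 0) {l : ℝ} (hl : 0 < l) :
    Integrable (f l) := by
  obtain ⟨C, hC, H⟩ := hf.bound l hl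
  refine integrable_of_abs_le_exp (C := C * exp (a * l)) hk (hf.cont l hl) fun x => ?_
  rw [mul_assoc, ← exp_add]
  exact (H l le_rfl x).1

theorem tendsto_cocompact (hf : ExpBdd a k f f') (hk : k < 0) {l : ℝ} (hl : 0 < l) :
    Tendsto (f l) (cocompact ℝ) (𝓝 0) := by
  obtain ⟨C, hC, H⟩ := hf.bound l hl
  refine squeeze_zero_norm (fun x => (H l le_rfl x).1) ?_
  rw [← mul_zero C]
  refine Tendsto.const_mul C (tendsto_exp_atBot.comp ?_)
  refine tendsto_atBot_add_const_left _ _ ?_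
  exact tendsto_norm_cocompact_atTop.const_mul_atTop_of_neg hk

/-- Domination for differentiating under the integral sign: on `(l/2, 2l)` the factor `exp (a y)` is
bounded and only `exp (k|x|)` remains. -/
theorem bound_near (hf : ExpBdd a k f f') {l : ℝ} (hl : 0 < l) :
    ∃ D, ∀ y ∈ Set.Ioo (l / 2) (2 * l), ∀ x, |f' y x| ≤ D * exp (k * |x|) := by
  obtain ⟨C, hC, H⟩ := hf.bound (l / 2) (by linarith)
  refine ⟨C * exp (|a| * (2 * l)), fun y hy x => ((H y hy.1.le x).2).trans ?_⟩
  rw [mul_assoc, ← exp_add]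
  have : a * y ≤ |a| * (2 * l) :=
    mul_le_mul (le_abs_self a) hy.2.le (by linarith [hy.1]) (abs_nonneg a)
  gcongr

theorem integral (hf : ExpBdd a k f f') (hk : k < 0) :
    ExpBdd a 0 (fun l _ => ∫ x, f l x) (fun l _ => ∫ x, f' l x) where
  deriv l hl _ := by
    obtain ⟨D, hD⟩ := hf.bound_near hl
    refine (hasDerivAt_integral_of_dominated_loc_of_deriv_le
      (bound := fun x => D * exp (k * |x|)) (Ioo_mem_nhds (by linarith) (by linarith)) ?_
      (hf.integrable hk hl) (hf.cont' l hl).aestronglyMeasurable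
      (.of_forall fun x y hy => hD y hy x) ((integrable_exp_mul_abs hk).const_mul D)
      (.of_forall fun x y hy => hf.deriv y (by linarith [hy.1]) x)).2
    filter_upwards [lt_mem_nhds hl] with y hy using (hf.cont y hy).aestronglyMeasurable
  cont _ _ := continuous_const
  cont' _ _ := continuous_const
  bound ε hε := by
    obtain ⟨C, hC, H⟩ := hf.bound ε hε
    have h0 : 0 ≤ ∫ x : ℝ, exp (k * |x|) := integral_nonneg fun x => (exp_pos _).le
    refine ⟨C * ∫ x : ℝ, exp (k * |x|), by positivity, fun l hl x => ?_⟩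
    have e (y : ℝ) : C * exp (a * l + k * |y|) = C * exp (a * l) * exp (k * |y|) := by
      rw [exp_add]; ring
    have h1 := abs_integral_le_of_abs_le_exp (f := f l) (C := C * exp (a * l)) hk
      (fun y => e y ▸ (H l hl y).1)
    have h2 := abs_integral_le_of_abs_le_exp (f := f' l) (C := C * exp (a * l)) hk
      (fun y => e y ▸ (H l hl y).2)
    rw [mul_right_comm] at h1 h2
    simp only [zero_mul, add_zero]
    exact ⟨h1, h2⟩

theorem primitive (hf : ExpBdd a k f f') (hk : 0 < k) :
    ExpBdd a k (fun l x => ∫ t in 0..x, f l t) (fun l x => ∫ t in 0..x, f' l t) where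
  deriv l hl x := by
    obtain ⟨D, hD⟩ := hf.bound_near hl
    have hc : Continuous fun x : ℝ => D * exp (k * |x|) := by fun_prop
    refine (intervalIntegral.hasDerivAt_integral_of_dominated_loc_of_deriv_le
      (bound := fun x => D * exp (k * |x|)) (Ioo_mem_nhds (by linarith) (by linarith)) ?_
      ((hf.cont l hl).intervalIntegrable _ _) (hf.cont' l hl).aestronglyMeasurable
      (.of_forall fun x _ y hy => hD y hy x) (hc.intervalIntegrable _ _)
      (.of_forall fun x _ y hy => hf.deriv y (by linarith [hy.1]) x)).2
    filter_upwards [lt_mem_nhds hl] with y hy using (hf.cont y hy).aestronglyMeasurable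
  cont l hl := intervalIntegral.continuous_primitive
    (fun _ _ => (hf.cont l hl).intervalIntegrable _ _) 0
  cont' l hl := intervalIntegral.continuous_primitive
    (fun _ _ => (hf.cont' l hl).intervalIntegrable _ _) 0
  bound ε hε := by
    obtain ⟨C, hC, H⟩ := hf.bound ε hε
    refine ⟨C / k, by positivity, fun l hl x => ?_⟩
    have e (y : ℝ) : C * exp (a * l + k * |y|) = C * exp (a * l) * exp (k * |y|) := by
      rw [exp_add]; ring
    have h1 := abs_primitive_le_of_abs_le_exp (f := f l) (C := C * exp (a * l)) hk (by positivity)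
      (fun y => e y ▸ (H l hl y).1) x
    have h2 := abs_primitive_le_of_abs_le_exp (f := f' l) (C := C * exp (a * l)) hk (by positivity)
      (fun y => e y ▸ (H l hl y).2) x
    have e2 : C / k * exp (a * l + k * |x|) = C * exp (a * l) / k * exp (k * |x|) := by
      rw [exp_add]; ring
    rw [e2]
    exact ⟨h1, h2⟩

theorem of_param {φ φ' : ℝ → ℝ} (hd : ∀ l, 0 < l → HasDerivAt φ (φ' l) l)
    (hb : ∀ ε, 0 < ε → ∃ C, ∀ l, ε ≤ l → |φ l| ≤ C * exp (a * l) ∧ |φ' l| ≤ C * exp (a * l)) :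
    ExpBdd a 0 (fun l _ => φ l) (fun l _ => φ' l) where
  deriv l hl _ := hd l hl
  cont _ _ := continuous_const
  cont' _ _ := continuous_const
  bound ε hε := by
    obtain ⟨C, H⟩ := hb ε hε
    refine ⟨C, ?_, fun l hl x => by simpa using H l hl⟩
    have := (abs_nonneg _).trans (H ε le_rfl).1
    exact nonneg_of_mul_nonneg_left this (exp_pos _)

end ExpBdd

/-! ### Exponential bounds for the basic profiles. -/

theorem expBdd_const (c : ℝ) : ExpBdd 0 0 (fun _ _ => c) (fun _ _ => 0) :=
  .of_param (fun l _ => hasDerivAt_const l c) fun _ _ => ⟨|c|, fun _ _ => by simp⟩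

theorem expBdd_inv : ExpBdd 0 0 (fun l _ => 1 / l) (fun l _ => -(1 / l ^ 2)) := by
  refine .of_param (φ := fun l => 1 / l) (φ' := fun l => -(1 / l ^ 2))
    (fun l hl => by simpa using hasDerivAt_inv hl.ne') fun ε hε => ?_
  refine ⟨1 / ε + 1 / ε ^ 2, fun l hl => ?_⟩
  have hl' := hε.trans_le hl
  have h1 : 1 / l ≤ 1 / ε := by gcongr
  have h2 : 1 / l ^ 2 ≤ 1 / ε ^ 2 := by gcongr
  have h3 : 0 < 1 / ε := by positivity
  have h4 : 0 < 1 / ε ^ 2 := by positivity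
  rw [abs_neg, abs_of_pos (by positivity : 0 < 1 / l), abs_of_pos (by positivity : 0 < 1 / l ^ 2)]
  simp only [zero_mul, exp_zero, mul_one]
  constructor <;> linarith

theorem amp_mono {l l' : ℝ} (h : l ≤ l') : amp l ≤ amp l' := by
  have hd : Differentiable ℝ amp := fun x => (hasDerivAt_amp x).differentiableAt
  refine monotone_of_deriv_nonneg hd (fun x => ?_) h
  rw [(hasDerivAt_amp x).deriv]
  have := tanh_sq_lt_one (2 * x)
  rw [amp]; linarith

theorem expBdd_amp : ExpBdd 0 0 (fun l _ => amp l) (fun l _ => 2 * (1 - amp l ^ 2)) := by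
  refine .of_param (φ := amp) (φ' := fun l => 2 * (1 - amp l ^ 2)) (fun l _ => hasDerivAt_amp l)
    fun ε hε => ⟨2, fun l hl => ?_⟩
  have h1 := amp_pos (hε.trans_le hl)
  have h2 := amp_lt_one l
  simp only [zero_mul, exp_zero, mul_one]
  rw [abs_of_pos h1, abs_of_nonneg (by nlinarith)]
  constructor <;> nlinarith

theorem expBdd_inv_amp :
    ExpBdd 0 0 (fun l _ => 1 / amp l) (fun l _ => -(2 * (1 - amp l ^ 2)) / amp l ^ 2) := by
  refine .of_param (φ := fun l => 1 / amp l) (φ' := fun l => -(2 * (1 - amp l ^ 2)) / amp l ^ 2)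
    (fun l hl => by simp only [one_div]; exact (hasDerivAt_amp l).inv (amp_pos hl).ne')
    fun ε hε => ⟨1 / amp ε + 2 / amp ε ^ 2, fun l hl => ?_⟩
  have h0 := amp_pos hε
  have h1 := amp_pos (hε.trans_le hl)
  have h2 := amp_lt_one l
  have h3 := amp_mono hl
  have h4 : 1 / amp l ≤ 1 / amp ε := by gcongr
  have h5 : 2 * (1 - amp l ^ 2) / amp l ^ 2 ≤ 2 / amp ε ^ 2 := by
    gcongr
    nlinarith
  have h6 : 0 ≤ 2 * (1 - amp l ^ 2) / amp l ^ 2 := div_nonneg (by nlinarith) (by positivity)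
  have h7 : 0 < 1 / amp l := by positivity
  simp only [zero_mul, exp_zero, mul_one]
  rw [abs_of_pos h7, neg_div, abs_neg, abs_of_nonneg h6]
  constructor <;> linarith

theorem expBdd_bump {k : ℝ} (hk : 0 ≤ k) (hk2 : k ≤ 2) :
    ExpBdd k (-k) bump (fun l x => 2 * (bump l x / amp l) - bump l x ^ 2) where
  deriv l hl x := hasDerivAt_bump_param hl x
  cont l _ := continuous_bump l
  cont' l _ := by have := continuous_bump l; fun_prop
  bound ε hε := by
    have h0 := amp_pos hε
    refine ⟨(1 + (2 / amp ε + 2)) * 2, by positivity, fun l hl x => ?_⟩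
    have hl' := hε.trans_le hl
    have h1 := bump_le_exp_of_le_two hl' hk hk2 x
    rw [show k * (l - |x|) = k * l + -k * |x| by ring] at h1
    have h2 := bump_pos hl' x
    have h3 : 2 / amp l ≤ 2 / amp ε := by have := amp_mono hl; gcongr
    have h4 : bump l x ≤ 2 := (le_abs_self _).trans (abs_bump_le_two l x)
    have h5 : |2 * (bump l x / amp l) - bump l x ^ 2| ≤ (2 / amp ε + 2) * bump l x := by
      have : 2 * (bump l x / amp l) - bump l x ^ 2 = (2 / amp l - bump l x) * bump l x := by ring
      have := amp_pos hl'
      have h6 : 0 < 2 / amp l := by positivity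
      rw [‹2 * (bump l x / amp l) - bump l x ^ 2 = _›, abs_mul, abs_of_pos h2]
      gcongr
      rw [abs_le]
      constructor <;> linarith
    have h7 : 0 < 2 / amp ε := by positivity
    rw [abs_of_pos h2]
    have h8 := exp_pos (k * l + -k * |x|)
    constructor
    · nlinarith
    · refine h5.trans ?_
      calc _ ≤ (2 / amp ε + 2) * (2 * exp (k * l + -k * |x|)) := by gcongr
        _ ≤ _ := by nlinarith

theorem expBdd_frontSum :
    ExpBdd 0 0 frontSum (fun l x => -(bump l x * frontSum l x)) where
  deriv l _ x := hasDerivAt_frontSum_param l x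
  cont l _ := continuous_frontSum l
  cont' l _ := ((continuous_bump l).mul (continuous_frontSum l)).neg
  bound ε hε := by
    refine ⟨4, by norm_num, fun l _ x => ?_⟩
    have h1 := abs_frontSum_le_two l x
    have h2 := abs_bump_le_two l x
    simp only [zero_mul, add_zero, exp_zero, mul_one]
    rw [abs_neg, abs_mul]
    constructor <;> nlinarith [abs_nonneg (frontSum l x), abs_nonneg (bump l x)]

theorem expBdd_slope :
    ExpBdd 0 0 slope (fun l x =>
      -(slope l x / l) + frontSum l x - slope l x * (2 / amp l - bump l x)) where
  deriv l hl x := hasDerivAt_slope_param hl x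
  cont l hl := continuous_slope hl
  cont' l hl := by
    have := continuous_slope hl
    have := continuous_frontSum l
    have := continuous_bump l
    fun_prop
  bound ε hε := by
    have h0 := amp_pos hε
    set B := (8 + 2 / ε) / amp ε with hB
    have hB0 : 0 < B := by positivity
    refine ⟨B + (B / ε + 2 + B * (2 / amp ε + 2)), by positivity, fun l hl x => ?_⟩
    have hl' := hε.trans_le hl
    have hT := amp_pos hl'
    have hT' := amp_mono hl
    have h1 : |slope l x| ≤ B := (abs_slope_le hl' x).trans (by rw [hB]; gcongr)
    have h2 := abs_frontSum_le_two l x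
    have h3 := abs_bump_le_two l x
    have h4 : |2 / amp l| ≤ 2 / amp ε := by rw [abs_of_pos (by positivity)]; gcongr
    have h5 : |slope l x / l| ≤ B / ε := by
      rw [abs_div, abs_of_pos hl']; gcongr
    have h6 : |slope l x * (2 / amp l - bump l x)| ≤ B * (2 / amp ε + 2) := by
      rw [abs_mul]
      gcongr
      exact (abs_sub _ _).trans (add_le_add h4 h3)
    have h7 : 0 < B / ε := by positivity
    have h8 : 0 < B * (2 / amp ε + 2) := by positivity
    simp only [zero_mul, add_zero, exp_zero, mul_one]
    refine ⟨by linarith, (abs_sub _ _).trans ?_⟩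
    have := abs_add_le (-(slope l x / l)) (frontSum l x)
    rw [abs_neg] at this
    linarith

theorem integrable_bump {l : ℝ} (hl : 0 < l) : Integrable (bump l) :=
  (expBdd_bump zero_le_two le_rfl).integrable (by norm_num) hl

theorem integral_bump {l : ℝ} (hl : 0 < l) : ∫ x, bump l x = 4 * l := by
  have h := tendsto_bumpPrim_atTop hl
  rw [integral_of_hasDerivAt_of_tendsto (hasDerivAt_bumpPrim l) (integrable_bump hl)
    (tendsto_atBot_of_odd (bumpPrim_neg l) h) h]
  ring

/-! ### The explicit phase corrector. -/

/-- The primitive, vanishing at the origin, of the derivative of the phase `q / r`. -/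
def phaseZero (l x : ℝ) : ℝ := ∫ t in 0..x, -2 * (1 / amp l) * slope l t

/-- The quotient `q / r` of the corrector and the pulse. -/
def phase (l x : ℝ) : ℝ := phaseZero l x - (∫ y, bump l y * phaseZero l y) * (1 / 4 * (1 / l))

/-- The explicit phase corrector. -/
def corrector (l x : ℝ) : ℝ := pulse l x * phase l x

/-- The frequency parameter of the explicit phase corrector. -/
def freq (l : ℝ) : ℝ := 3 / 4 - 3 / 8 * (amp l / l)

theorem exists_expBdd_phaseZero : ∃ f', ExpBdd 0 (1 / 8) phaseZero f' := by
  have h := ((expBdd_inv_amp.const_mul (-2)).mul expBdd_slope).mono (a₂ := 0) (k₂ := 1 / 8)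
    (by norm_num) (by norm_num)
  exact ⟨_, h.primitive (by norm_num)⟩

/-- The rate `1/8` in `x` is an arbitrary small one, so that even the squared phase is beaten by
`bump` decaying at rate `1/2`. Using `bump` at that rate in the mean value costs only `exp (l / 2)`.
-/
theorem exists_expBdd_phase : ∃ f', ExpBdd (1 / 2) (1 / 8) phase f' := by
  obtain ⟨f', hf⟩ := exists_expBdd_phaseZero
  have hb : ExpBdd (1 / 2) (-(1 / 2)) bump _ := expBdd_bump (by norm_num) (by norm_num)
  have h1 := (hb.mul hf).integral (by norm_num)
  have h2 := (h1.mul (expBdd_inv.const_mul (1 / 4))).mono (a₂ := 1 / 2) (k₂ := 1 / 8)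
    (by norm_num) (by norm_num)
  exact ⟨_, (hf.mono (by norm_num) le_rfl).sub h2⟩

theorem hasDerivAt_phase {l : ℝ} (hl : 0 < l) (x : ℝ) :
    HasDerivAt (phase l) (-2 * (1 / amp l) * slope l x) x := by
  have hc := continuous_slope hl
  have hc' : Continuous fun t => -2 * (1 / amp l) * slope l t := by fun_prop
  exact (intervalIntegral.integral_hasDerivAt_right (hc'.intervalIntegrable _ _)
    (hc'.stronglyMeasurableAtFilter _ _) hc'.continuousAt).sub_const _

theorem continuous_phase {l : ℝ} (hl : 0 < l) : Continuous (phase l) :=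
  continuous_iff_continuousAt.2 fun x => (hasDerivAt_phase hl x).continuousAt

theorem integral_bump_mul_phase {l : ℝ} (hl : 0 < l) : ∫ x, bump l x * phase l x = 0 := by
  obtain ⟨f', hf⟩ := exists_expBdd_phaseZero
  have hb : ExpBdd (1 / 2) (-(1 / 2)) bump _ := expBdd_bump (by norm_num) (by norm_num)
  have h1 := (hb.mul hf).integrable (by norm_num) hl
  simp only [phase, mul_sub]
  -- Since `∫ bump = 4l`, the constant subtracted in `phase` is the `bump`-weighted mean of
  -- `phaseZero`.
  rw [integral_sub h1 ((integrable_bump hl).mul_const _), integral_mul_const, integral_bump hl]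
  field_simp
  ring

/-- The first derivative of the explicit phase corrector. -/
def correctorDeriv (l x : ℝ) : ℝ :=
  pulse l x * (-(frontSum l x * phase l x) / 2 - 2 * (1 / amp l) * slope l x)

/-- The second derivative of the explicit phase corrector. -/
def correctorDeriv₂ (l x : ℝ) : ℝ :=
  pulse l x * ((frontSum l x ^ 2 / 4 - (2 * (bump l x / amp l) - bump l x ^ 2) / 2) * phase l x
    - 2 * (1 / amp l) * (1 / l - 2 * (1 / amp l) + bump l x))

theorem hasDerivAt_corrector {l : ℝ} (hl : 0 < l) (x : ℝ) :
    HasDerivAt (corrector l) (correctorDeriv l x) x := by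
  refine ((hasDerivAt_pulse hl x).mul (hasDerivAt_phase hl x)).congr_deriv ?_
  rw [correctorDeriv]; ring

theorem hasDerivAt_correctorDeriv {l : ℝ} (hl : 0 < l) (x : ℝ) :
    HasDerivAt (correctorDeriv l) (correctorDeriv₂ l x) x := by
  refine ((hasDerivAt_pulse hl x).mul
    (((((hasDerivAt_frontSum hl x).mul (hasDerivAt_phase hl x)).neg).div_const 2).sub
      ((hasDerivAt_slope hl x).const_mul (2 * (1 / amp l))))).congr_deriv ?_
  simp only [Pi.mul_apply, Pi.neg_apply, Pi.sub_apply]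
  rw [correctorDeriv₂]; ring

theorem continuous_correctorDeriv₂ {l : ℝ} (hl : 0 < l) : Continuous (correctorDeriv₂ l) := by
  have := continuous_pulse hl
  have := continuous_phase hl
  have := continuous_bump l
  have := continuous_frontSum l
  unfold correctorDeriv₂
  fun_prop

/-- The squared pulse decays at rate 2 and the square of `f` grows at rate at most `2k`. -/
theorem memLp_two_pulse_mul {a k : ℝ} {f f' : ℝ → ℝ → ℝ} (hf : ExpBdd a k f f') (hk : k < 1)
    {l : ℝ} (hl : 0 < l) : MemLp (fun x => pulse l x * f l x) 2 := by
  have hc := continuous_pulse hl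
  have hc' := hf.cont l hl
  rw [memLp_two_iff_integrable_sq (f := fun x => pulse l x * f l x)
    (hc.mul hc').aestronglyMeasurable]
  have h1 := (expBdd_bump zero_le_two le_rfl).mul hf.pow_two
  have h2 := (h1.integrable (by linarith) hl).const_mul (3 / 8 * amp l)
  refine h2.congr (.of_forall fun x => ?_)
  simp only [mul_pow, pulse_sq hl]
  ring

theorem memLp_two_pulse {l : ℝ} (hl : 0 < l) : MemLp (pulse l) 2 := by
  simpa using memLp_two_pulse_mul (expBdd_const 1) (by norm_num) hl

theorem absolutelyContinuousOnInterval_of_hasDerivAt {f f' : ℝ → ℝ}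
    (h : ∀ x, HasDerivAt f (f' x) x) (hc : Continuous f') (a b : ℝ) :
    AbsolutelyContinuousOnInterval f a b := by
  refine ContDiffOn.absolutelyContinuousOnInterval (ContDiff.contDiffOn ?_)
  rw [contDiff_one_iff_deriv, show deriv f = f' from funext fun x => (h x).deriv]
  exact ⟨fun x => (h x).differentiableAt, hc⟩

theorem memH2_corrector {l : ℝ} (hl : 0 < l) : MemH2 (corrector l) := by
  have e1 : deriv (corrector l) = correctorDeriv l :=
    funext fun x => (hasDerivAt_corrector hl x).deriv
  have e2 : deriv (correctorDeriv l) = correctorDeriv₂ l :=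
    funext fun x => (hasDerivAt_correctorDeriv hl x).deriv
  obtain ⟨f', hf⟩ := exists_expBdd_phase
  have hb : ExpBdd 0 0 bump _ := (expBdd_bump le_rfl zero_le_two).mono (by norm_num) (by norm_num)
  refine ⟨fun x => (hasDerivAt_corrector hl x).differentiableAt, fun a b => ?_,
    memLp_two_pulse_mul hf (by norm_num) hl, ?_, ?_⟩
  · rw [e1]
    exact absolutelyContinuousOnInterval_of_hasDerivAt (hasDerivAt_correctorDeriv hl)
      (continuous_correctorDeriv₂ hl) a b
  · rw [e1]
    have h1 := ((expBdd_frontSum.mul hf).const_mul (-1 / 2)).mono (a₂ := 1) (k₂ := 1 / 8)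
      (by norm_num) (by norm_num)
    have h2 := ((expBdd_inv_amp.const_mul 2).mul expBdd_slope).mono (a₂ := 1) (k₂ := 1 / 8)
      (by norm_num) (by norm_num)
    convert! memLp_two_pulse_mul (h1.sub h2) (by norm_num) hl using 2 with x
    rw [correctorDeriv]; ring
  · rw [e1, e2]
    have h1 := (((expBdd_frontSum.pow_two.const_mul (1 / 4)).mono (a₂ := 1 / 2) (k₂ := 1 / 8)
      (by norm_num) (by norm_num)).sub ((((hb.mul expBdd_inv_amp).const_mul 2).sub
      (hb.pow_two.mono (by norm_num) (by norm_num))).const_mul (1 / 2) |>.mono (a₂ := 1 / 2)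
      (k₂ := 1 / 8) (by norm_num) (by norm_num))).mul hf
    have h2 := ((expBdd_inv_amp.const_mul 2).mul ((expBdd_inv.sub
      (expBdd_inv_amp.const_mul 2)).add hb)).mono (a₂ := 1 / 2 + 1 / 2) (k₂ := 1 / 8 + 1 / 8)
      (by norm_num) (by norm_num)
    convert! memLp_two_pulse_mul (h1.sub h2) (by norm_num) hl using 2 with x
    rw [correctorDeriv₂]; ring

/-- For `q = rφ` the equation is `-m(r²φ')' = r⁴ - θr²`; `freq l` is the value of `θ` that balances
the integrals of `r⁴` and `θr²`. -/
theorem isPhaseCorrector_corrector {ν l : ℝ} (hl : 0 < l) (hν : mass ν = 3 / 16 * amp l ^ 2) :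
    IsPhaseCorrector ν (pulse l) (freq l) (corrector l) where
  memH2 := memH2_corrector hl
  orthogonal := by
    have e (x : ℝ) : corrector l x * pulse l x = 3 / 8 * amp l * (bump l x * phase l x) := by
      rw [corrector]; linear_combination phase l x * pulse_sq hl x
    simp only [e]
    rw [integral_const_mul, integral_bump_mul_phase hl, mul_zero]
  eqn := by
    refine .of_forall fun x => ?_
    have hT := (amp_pos hl).ne'
    rw [show deriv (corrector l) = correctorDeriv l from
      funext fun x => (hasDerivAt_corrector hl x).deriv, (hasDerivAt_correctorDeriv hl x).deriv, hν,
      correctorDeriv₂, corrector, freq]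
    have h1 := pulse_mass_eq hl x
    have h2 := pulse_sq hl x
    have e : amp l ^ 2 * (1 / amp l) * (1 / l - 2 * (1 / amp l) + bump l x)
        = amp l / l - 2 + amp l * bump l x := by field_simp
    linear_combination -(pulse l x * phase l x) * h1 + 3 / 8 * pulse l x * e - pulse l x * h2

/-! ### Uniqueness of the phase corrector. -/

/-- An absolutely continuous function is the integral of its a.e. derivative; if that agrees a.e.
with a continuous function, the derivative exists everywhere. -/
theorem hasDerivAt_deriv_of_ae_eq {q h : ℝ → ℝ} (hq : MemH2 q) (hh : Continuous h)
    (e : ∀ᵐ x, deriv (deriv q) x = h x) (x : ℝ) : HasDerivAt (deriv q) (h x) x := by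
  have e' : deriv q = fun x => (∫ t in 0..x, h t) + deriv q 0 := by
    funext y
    have h1 := (hq.absCont 0 y).integral_deriv_eq_sub
    rw [intervalIntegral.integral_congr_ae (g := h) (e.mono fun t ht _ => ht)] at h1
    linarith
  rw [e']
  exact (intervalIntegral.integral_hasDerivAt_right (hh.intervalIntegrable _ _)
    (hh.stronglyMeasurableAtFilter _ _) hh.continuousAt).add_const _

theorem IsPhaseCorrector.hasDerivAt_deriv {ν θ l : ℝ} {q : ℝ → ℝ} (hl : 0 < l)
    (hν : mass ν = 3 / 16 * amp l ^ 2) (h : IsPhaseCorrector ν (pulse l) θ q) (x : ℝ) :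
    HasDerivAt (deriv q) ((mass ν * q x - pulse l x ^ 2 * q x + pulse l x ^ 4 * q x
      - pulse l x ^ 3 + θ * pulse l x) / mass ν) x := by
  have hm : 0 < mass ν := by rw [hν]; have := amp_pos hl; positivity
  have hc := continuous_pulse hl
  have hq := h.memH2.differentiable.continuous
  refine hasDerivAt_deriv_of_ae_eq h.memH2 (h := fun x => (mass ν * q x - pulse l x ^ 2 * q x
    + pulse l x ^ 4 * q x - pulse l x ^ 3 + θ * pulse l x) / mass ν) (by fun_prop) ?_ x
  filter_upwards [h.eqn] with x hx
  rw [eq_div_iff hm.ne']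
  linear_combination -hx

theorem IsPhaseCorrector.unique {ν θ₁ θ₂ l : ℝ} {q₁ q₂ : ℝ → ℝ} (hl : 0 < l)
    (hν : mass ν = 3 / 16 * amp l ^ 2) (h₁ : IsPhaseCorrector ν (pulse l) θ₁ q₁)
    (h₂ : IsPhaseCorrector ν (pulse l) θ₂ q₂) : θ₁ = θ₂ ∧ q₁ = q₂ := by
  have hT := amp_pos hl
  have hm : 0 < mass ν := by rw [hν]; positivity
  -- Wronskian of `q₁ - q₂` and `r`. Since `r` solves the homogeneous equation, `W' = (θ₁ - θ₂) r² /
  -- m`.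
  set W : ℝ → ℝ := fun x => (deriv q₁ x - deriv q₂ x) * pulse l x -
    (q₁ x - q₂ x) * -(pulse l x * frontSum l x / 2) with hW
  have dq (x : ℝ) : HasDerivAt (fun x => q₁ x - q₂ x) (deriv q₁ x - deriv q₂ x) x :=
    (h₁.memH2.differentiable x).hasDerivAt.sub (h₂.memH2.differentiable x).hasDerivAt
  have dW (x : ℝ) : HasDerivAt W ((θ₁ - θ₂) / mass ν * (3 / 8 * amp l) * bump l x) x := by
    refine ((((h₁.hasDerivAt_deriv hl hν x).sub (h₂.hasDerivAt_deriv hl hν x)).mul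
      (hasDerivAt_pulse hl x)).sub ((dq x).mul (hasDerivAt_pulse_deriv hl x))).congr_deriv ?_
    simp only [Pi.sub_apply]
    have e := pulse_mass_eq hl x
    rw [← hν] at e
    have e2 := pulse_sq hl x
    field_simp at e ⊢
    linear_combination -8 * (q₁ x - q₂ x) * pulse l x * e + 64 * (θ₁ - θ₂) * amp l * e2
  have iW' : Integrable fun x => (θ₁ - θ₂) / mass ν * (3 / 8 * amp l) * bump l x :=
    (integrable_bump hl).const_mul _
  have mr := memLp_two_pulse hl
  have mr' : MemLp (fun x => -(pulse l x * frontSum l x / 2)) 2 := by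
    convert! memLp_two_pulse_mul (expBdd_frontSum.const_mul (-1 / 2)) (by norm_num) hl using 2
      with x
    ring
  have iW : Integrable W :=
    ((h₁.memH2.memLp_deriv.sub h₂.memH2.memLp_deriv).integrable_mul mr).sub
      ((h₁.memH2.memLp.sub h₂.memH2.memLp).integrable_mul mr')
  have eW (x : ℝ) : W x = (θ₁ - θ₂) / mass ν * (3 / 8 * amp l) * bumpPrim l x + W 0 := by
    have := is_const_of_hasDerivAt_zero
      (f := fun x => W x - (θ₁ - θ₂) / mass ν * (3 / 8 * amp l) * bumpPrim l x)
      (fun y => ((dW y).sub ((hasDerivAt_bumpPrim l y).const_mul _)).congr_deriv (sub_self _)) x 0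
    have h0 : bumpPrim l 0 = 0 := by simp [bumpPrim]
    simp only [h0, mul_zero, sub_zero] at this
    linarith
  -- `W` and `W'` are integrable, so `W` vanishes at both ends; but its limits there differ by a
  -- multiple of `(θ₁ - θ₂) · 4l`.
  have t1 := tendsto_zero_of_hasDerivAt_of_integrableOn_Ioi (a := 0) (fun x _ => dW x)
    iW'.integrableOn iW.integrableOn
  have t2 := tendsto_zero_of_hasDerivAt_of_integrableOn_Iic (a := 0) (fun x _ => dW x)
    iW'.integrableOn iW.integrableOn
  have hb := tendsto_bumpPrim_atTop hl
  have s1 := (hb.const_mul ((θ₁ - θ₂) / mass ν * (3 / 8 * amp l))).add_const (W 0)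
  have s2 := ((tendsto_atBot_of_odd (bumpPrim_neg l) hb).const_mul
    ((θ₁ - θ₂) / mass ν * (3 / 8 * amp l))).add_const (W 0)
  have u1 := tendsto_nhds_unique t1 (s1.congr fun x => (eW x).symm)
  have u2 := tendsto_nhds_unique t2 (s2.congr fun x => (eW x).symm)
  have hθ : (θ₁ - θ₂) / mass ν * (3 / 8 * amp l) = 0 := by
    have : (θ₁ - θ₂) / mass ν * (3 / 8 * amp l) * (4 * l) = 0 := by linarith
    exact (mul_eq_zero.1 this).resolve_right (by positivity)
  have hθ' : θ₁ = θ₂ := by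
    have := (mul_eq_zero.1 hθ).resolve_right (by positivity)
    exact sub_eq_zero.1 ((div_eq_zero_iff.1 this).resolve_right hm.ne')
  have hW0 (x : ℝ) : W x = 0 := by
    rw [eW, hθ]
    rw [hθ] at u1
    linarith
  refine ⟨hθ', ?_⟩
  have hp (x : ℝ) := (pulse_pos hl x).ne'
  -- With `W = 0` the difference is a constant multiple of `r`, and orthogonality to `r` makes the
  -- constant zero.
  have hquot (x : ℝ) : HasDerivAt (fun x => (q₁ x - q₂ x) / pulse l x) 0 x := by
    refine ((dq x).div (hasDerivAt_pulse hl x) (hp x)).congr_deriv ?_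
    rw [div_eq_zero_iff]
    exact .inl (hW0 x)
  set c := (q₁ 0 - q₂ 0) / pulse l 0 with hc
  have hd (x : ℝ) : q₁ x - q₂ x = c * pulse l x := by
    rw [hc, ← is_const_of_hasDerivAt_zero hquot x 0, div_mul_cancel₀ _ (hp x)]
  have horth : ∫ x, (q₁ x - q₂ x) * pulse l x = 0 := by
    simp only [sub_mul]
    rw [integral_sub (f := fun x => q₁ x * pulse l x) (g := fun x => q₂ x * pulse l x)
      (h₁.memH2.memLp.integrable_mul mr) (h₂.memH2.memLp.integrable_mul mr), h₁.orthogonal,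
      h₂.orthogonal, sub_zero]
  have hc0 : c * (3 / 8 * amp l) * (4 * l) = 0 := by
    rw [← horth, ← integral_bump hl, ← integral_const_mul]
    refine integral_congr_ae (.of_forall fun x => ?_)
    simp only [hd]
    linear_combination -c * pulse_sq hl x
  have : c = 0 := by
    have := (mul_eq_zero.1 hc0).resolve_right (by positivity)
    exact (mul_eq_zero.1 this).resolve_right (by positivity)
  funext x
  have := hd x
  rw [‹c = 0›] at this
  linarith

/-! ### Integrals in closed form. -/

theorem integral_eq_zero_of_hasDerivAt {f f' : ℝ → ℝ} (h : ∀ x, HasDerivAt f (f' x) x)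
    (hf' : Integrable f') (hf : Tendsto f (cocompact ℝ) (𝓝 0)) : ∫ x, f' x = 0 := by
  rw [integral_of_hasDerivAt_of_tendsto h hf' (hf.mono_left atBot_le_cocompact)
    (hf.mono_left atTop_le_cocompact), sub_zero]

theorem expBdd_bump' : ExpBdd 2 (-2) bump (fun l x => 2 * (bump l x / amp l) - bump l x ^ 2) :=
  expBdd_bump zero_le_two le_rfl

theorem expBdd_bump₀ : ExpBdd 0 0 bump (fun l x => 2 * (bump l x / amp l) - bump l x ^ 2) :=
  (expBdd_bump le_rfl zero_le_two).mono le_rfl (by norm_num)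

theorem expBdd_flux :
    ExpBdd 2 (-2) flux (fun l x => -(flux l x / l) + bump l x * frontSum l x) := by
  refine ((expBdd_slope.mul expBdd_bump').mono (by norm_num) (by norm_num)).congr
    (fun l hl x => flux_eq hl x) fun l hl x => ?_
  have := (amp_pos hl).ne'
  rw [flux_eq hl]
  field_simp
  ring

theorem tendsto_bumpPrim_atBot {l : ℝ} (hl : 0 < l) :
    Tendsto (bumpPrim l) atBot (𝓝 (-(2 * l))) :=
  tendsto_atBot_of_odd (bumpPrim_neg l) (tendsto_bumpPrim_atTop hl)

theorem tendsto_frontSum_atBot (l : ℝ) : Tendsto (frontSum l) atBot (𝓝 (-2)) :=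
  tendsto_atBot_of_odd (frontSum_neg l) (tendsto_frontSum_atTop l)

theorem integral_bump_sq {l : ℝ} (hl : 0 < l) : ∫ x, bump l x ^ 2 = 8 * l / amp l - 4 := by
  have hd (x : ℝ) : HasDerivAt (fun x => 2 * (bumpPrim l x / amp l) - frontSum l x)
      (bump l x ^ 2) x := by
    refine ((((hasDerivAt_bumpPrim l x).div_const (amp l)).const_mul 2).sub
      (hasDerivAt_frontSum hl x)).congr_deriv ?_
    ring
  rw [integral_of_hasDerivAt_of_tendsto hd
    (expBdd_bump'.pow_two.integrable (by norm_num) hl)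
    ((((tendsto_bumpPrim_atBot hl).div_const _).const_mul 2).sub (tendsto_frontSum_atBot l))
    ((((tendsto_bumpPrim_atTop hl).div_const _).const_mul 2).sub (tendsto_frontSum_atTop l))]
  ring

theorem integrable_bump_mul_frontSum_sq {l : ℝ} (hl : 0 < l) :
    Integrable fun x => bump l x * frontSum l x ^ 2 :=
  (expBdd_bump'.mul expBdd_frontSum.pow_two).integrable (by norm_num) hl

theorem hasDerivAt_bump_mul_frontSum {l : ℝ} (hl : 0 < l) (x : ℝ) :
    HasDerivAt (fun x => bump l x * frontSum l x) (-(bump l x * frontSum l x ^ 2) +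
      bump l x * (2 * (bump l x / amp l) - bump l x ^ 2)) x := by
  refine ((hasDerivAt_bump l x).mul (hasDerivAt_frontSum hl x)).congr_deriv ?_
  ring

theorem tendsto_bump_mul_frontSum {l : ℝ} (hl : 0 < l) :
    Tendsto (fun x => bump l x * frontSum l x) (cocompact ℝ) (𝓝 0) :=
  (expBdd_bump'.mul expBdd_frontSum).tendsto_cocompact (by norm_num) hl

theorem integral_bump_mul_frontSum_sq {l : ℝ} (hl : 0 < l) :
    ∫ x, bump l x * frontSum l x ^ 2 = 8 * l * (1 - 1 / amp l ^ 2) + 4 / amp l := by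
  have hT := (amp_pos hl).ne'
  have hd (x : ℝ) : HasDerivAt (fun x => 2 * (1 - 1 / amp l ^ 2) * bumpPrim l x
      + frontSum l x / amp l - 1 / 2 * (bump l x * frontSum l x)) (bump l x * frontSum l x ^ 2) x := by
    refine ((((hasDerivAt_bumpPrim l x).const_mul _).add
      ((hasDerivAt_frontSum hl x).div_const _)).sub
      ((hasDerivAt_bump_mul_frontSum hl x).const_mul (1 / 2))).congr_deriv ?_
    rw [frontSum_sq hl]
    field_simp
    ring
  have hb := tendsto_bump_mul_frontSum hl
  rw [integral_of_hasDerivAt_of_tendsto hd (integrable_bump_mul_frontSum_sq hl)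
    ((((tendsto_bumpPrim_atBot hl).const_mul _).add ((tendsto_frontSum_atBot l).div_const _)).sub
      ((hb.mono_left atBot_le_cocompact).const_mul _))
    ((((tendsto_bumpPrim_atTop hl).const_mul _).add ((tendsto_frontSum_atTop l).div_const _)).sub
      ((hb.mono_left atTop_le_cocompact).const_mul _))]
  ring

theorem integrable_flux_mul_frontSum_mul_bump {l : ℝ} (hl : 0 < l) :
    Integrable fun x => flux l x * frontSum l x * bump l x :=
  ((expBdd_flux.mul expBdd_frontSum).mul expBdd_bump').integrable (by norm_num) hl

theorem integral_flux_mul_frontSum_mul_bump {l : ℝ} (hl : 0 < l) :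
    ∫ x, flux l x * frontSum l x * bump l x
      = 8 / amp l - 4 / l - (8 * l * (1 - 1 / amp l ^ 2) + 4 / amp l) := by
  have hT := (amp_pos hl).ne'
  have hd (x : ℝ) : HasDerivAt (fun x => flux l x * bump l x + bump l x * frontSum l x)
      (1 / l * bump l x ^ 2 - bump l x * frontSum l x ^ 2 -
        flux l x * frontSum l x * bump l x) x := by
    -- Adding `(bump · frontSum)'` cancels the quadratic and cubic terms in `bump` that come from
    -- `flux' · bump`, except for `bump² / l`.
    refine (((hasDerivAt_flux hl x).mul (hasDerivAt_bump l x)).add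
      (hasDerivAt_bump_mul_frontSum hl x)).congr_deriv ?_
    field_simp
    ring
  have i1 : Integrable fun x => 1 / l * bump l x ^ 2 :=
    (expBdd_bump'.pow_two.integrable (by norm_num) hl).const_mul _
  have i2 := integrable_bump_mul_frontSum_sq hl
  have i3 := integrable_flux_mul_frontSum_mul_bump hl
  have h := integral_eq_zero_of_hasDerivAt hd ((i1.sub i2).sub i3) (by
    have := ((expBdd_flux.mul expBdd_bump').tendsto_cocompact (by norm_num) hl).add
      (tendsto_bump_mul_frontSum hl)
    simpa only [add_zero] using this)
  have e1 : ∫ x, (1 / l * bump l x ^ 2 - bump l x * frontSum l x ^ 2 -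
        flux l x * frontSum l x * bump l x) = _ := integral_sub (i1.sub i2) i3
  have e2 : ∫ x, (1 / l * bump l x ^ 2 - bump l x * frontSum l x ^ 2) = _ := integral_sub i1 i2
  rw [e1, e2, integral_const_mul, integral_bump_sq hl, integral_bump_mul_frontSum_sq hl] at h
  have : 1 / l * (8 * l / amp l - 4) = 8 / amp l - 4 / l := by field_simp
  linarith

theorem frontSum_eq (l x : ℝ) :
    frontSum l x = 2 * sinh (2 * x) / (cosh (2 * x) + cosh (2 * l)) := by
  -- Exchanging `x` and `l` turns the difference of fronts into their sum.
  have h := bump_eq x l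
  have e : l - x = -(x - l) := by ring
  rw [bump, e, tanh_neg, sub_neg_eq_add, add_comm l x] at h
  rw [frontSum, h, add_comm (cosh (2 * l))]

theorem bump_mul_sinh (l x : ℝ) : bump l x * sinh (2 * x) = sinh (2 * l) * frontSum l x := by
  rw [bump_eq, frontSum_eq]; ring

theorem abs_sinh_two_mul_le (x : ℝ) : |sinh (2 * x)| ≤ exp (2 * |x|) := by
  rw [sinh_eq, abs_le]
  have h1 : exp (2 * x) ≤ exp (2 * |x|) := exp_le_exp.2 (by linarith [le_abs_self x])
  have h2 : exp (-(2 * x)) ≤ exp (2 * |x|) := exp_le_exp.2 (by linarith [neg_abs_le x])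
  have h3 := exp_pos (2 * x)
  have h4 := exp_pos (-(2 * x))
  constructor <;> linarith

theorem abs_cosh_two_mul_le (x : ℝ) : |cosh (2 * x)| ≤ exp (2 * |x|) := by
  rw [cosh_eq, abs_le]
  have h1 : exp (2 * x) ≤ exp (2 * |x|) := exp_le_exp.2 (by linarith [le_abs_self x])
  have h2 : exp (-(2 * x)) ≤ exp (2 * |x|) := exp_le_exp.2 (by linarith [neg_abs_le x])
  have h3 := exp_pos (2 * x)
  have h4 := exp_pos (-(2 * x))
  constructor <;> linarith

/-- The squared flux decays at rate 4 and so absorbs a hyperbolic weight of rate 2. -/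
theorem exists_flux_sq_mul_le {l : ℝ} (hl : 0 < l) :
    ∃ C, ∀ x y : ℝ, |y| ≤ exp (2 * |x|) → |flux l x ^ 2 * y| ≤ C * exp (-2 * |x|) := by
  obtain ⟨C, hC, H⟩ := expBdd_flux.pow_two.bound l hl
  refine ⟨C * exp (4 * l), fun x y hy => ?_⟩
  rw [abs_mul]
  refine (mul_le_mul (H l le_rfl x).1 hy (abs_nonneg _) (by positivity)).trans_eq ?_
  rw [mul_assoc C, ← exp_add, mul_assoc C, ← exp_add]
  congr 2; ring

theorem integrable_flux_sq_mul_cosh {l : ℝ} (hl : 0 < l) :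
    Integrable fun x => flux l x ^ 2 * cosh (2 * x) := by
  obtain ⟨C, H⟩ := exists_flux_sq_mul_le hl
  have := expBdd_flux.cont l hl
  exact integrable_of_abs_le_exp (k := -2) (by norm_num) (by fun_prop)
    fun x => H x _ (abs_cosh_two_mul_le x)

/-- Integration by parts: `flux'` has the factor `bump`, and `bump · sinh (2x) = sinh (2l) ·
frontSum` removes the growing weight. -/
theorem integral_flux_sq_mul_cosh {l : ℝ} (hl : 0 < l) :
    ∫ x, flux l x ^ 2 * cosh (2 * x) = sinh (2 * l) *
      ((2 / amp l - 1 / l) * (∫ x, flux l x * frontSum l x)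
        - ∫ x, flux l x * frontSum l x * bump l x) := by
  have hT := (amp_pos hl).ne'
  have hd (x : ℝ) : HasDerivAt (fun x => 1 / 2 * (flux l x ^ 2 * sinh (2 * x)))
      (flux l x ^ 2 * cosh (2 * x) - (sinh (2 * l) * (2 / amp l - 1 / l) *
        (flux l x * frontSum l x) - sinh (2 * l) * (flux l x * frontSum l x * bump l x))) x := by
    have hs : HasDerivAt (fun x : ℝ => sinh (2 * x)) (cosh (2 * x) * (2 * 1)) x :=
      ((hasDerivAt_id x).const_mul 2).sinh
    refine ((((hasDerivAt_flux hl x).pow 2).mul hs).const_mul (1 / 2)).congr_deriv ?_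
    simp only [Pi.pow_apply]
    push_cast
    linear_combination flux l x * (1 / l - 2 / amp l + bump l x) * bump_mul_sinh l x
  have i1 := integrable_flux_sq_mul_cosh hl
  have i2 : Integrable fun x => sinh (2 * l) * (2 / amp l - 1 / l) *
      (flux l x * frontSum l x) :=
    ((expBdd_flux.mul expBdd_frontSum).integrable (by norm_num) hl).const_mul _
  have i3 : Integrable fun x => sinh (2 * l) * (flux l x * frontSum l x * bump l x) :=
    (integrable_flux_mul_frontSum_mul_bump hl).const_mul _
  have h := integral_eq_zero_of_hasDerivAt hd (i1.sub (i2.sub i3)) (by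
    obtain ⟨C, H⟩ := exists_flux_sq_mul_le hl
    have h0 := (tendsto_exp_mul_sub_abs 0 two_pos).const_mul C
    rw [mul_zero] at h0
    have h1 : Tendsto (fun x => flux l x ^ 2 * sinh (2 * x)) (cocompact ℝ) (𝓝 0) :=
      squeeze_zero_norm (a := fun x => C * exp (2 * (0 - |x|)))
        (fun x => (H x _ (abs_sinh_two_mul_le x)).trans_eq (by congr 2; ring)) h0
    simpa only [mul_zero] using h1.const_mul (1 / 2))
  have e1 : ∫ x, (flux l x ^ 2 * cosh (2 * x) - (sinh (2 * l) * (2 / amp l - 1 / l) *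
        (flux l x * frontSum l x) - sinh (2 * l) * (flux l x * frontSum l x * bump l x))) = _ :=
    integral_sub i1 (i2.sub i3)
  have e2 : ∫ x, (sinh (2 * l) * (2 / amp l - 1 / l) *
        (flux l x * frontSum l x) - sinh (2 * l) * (flux l x * frontSum l x * bump l x)) = _ :=
    integral_sub i2 i3
  rw [e1, e2, integral_const_mul, integral_const_mul] at h
  linarith

/-! ### The flux moment and the constant `π² / 3`. -/

/-- The parameter integral through which the leading part of the coefficient depends on `l`. -/
def fluxMoment (l : ℝ) : ℝ := l * ∫ x, flux l x * frontSum l x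

/-- The factor `l` cancels the term `-flux / l` of the parameter derivative, leaving integrals
already known in closed form. -/
theorem hasDerivAt_fluxMoment {l : ℝ} (hl : 0 < l) :
    HasDerivAt fluxMoment (4 + 16 * l ^ 2 * (1 - 1 / amp l ^ 2)) l := by
  have hT := (amp_pos hl).ne'
  have h := (hasDerivAt_id l).mul
    (((expBdd_flux.mul expBdd_frontSum).integral (by norm_num)).deriv l hl 0)
  refine h.congr_deriv ?_
  have i1 := (expBdd_flux.mul expBdd_frontSum).integrable (by norm_num) hl
  have i2 := integrable_bump_mul_frontSum_sq hl
  have i3 := integrable_flux_mul_frontSum_mul_bump hl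
  have e (x : ℝ) : (-(flux l x / l) + bump l x * frontSum l x) * frontSum l x
      + flux l x * -(bump l x * frontSum l x) = -(1 / l) * (flux l x * frontSum l x)
      + (bump l x * frontSum l x ^ 2 - flux l x * frontSum l x * bump l x) := by ring
  simp only [e, id]
  have e1 : ∫ x, (-(1 / l) * (flux l x * frontSum l x)
      + (bump l x * frontSum l x ^ 2 - flux l x * frontSum l x * bump l x)) = _ :=
    integral_add (i1.const_mul _) (i2.sub i3)
  have e2 : ∫ x, (bump l x * frontSum l x ^ 2 - flux l x * frontSum l x * bump l x) = _ :=
    integral_sub i2 i3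
  rw [e1, e2, integral_const_mul, integral_bump_mul_frontSum_sq hl,
    integral_flux_mul_frontSum_mul_bump hl]
  field_simp
  ring

theorem tendsto_fluxMoment_zero : Tendsto fluxMoment (𝓝[>] 0) (𝓝 0) := by
  have e : fluxMoment = fun l => ∫ x, l * (flux l x * frontSum l x) :=
    funext fun l => (integral_const_mul _ _).symm
  have hpos : ∀ᶠ l : ℝ in 𝓝[>] 0, 0 < l := eventually_mem_nhdsWithin
  have hle : ∀ᶠ l : ℝ in 𝓝[>] 0, l < 1 :=
    eventually_nhdsWithin_of_eventually_nhds (gt_mem_nhds one_pos)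
  suffices H : Tendsto (fun l => ∫ x, l * (flux l x * frontSum l x)) (𝓝[>] 0)
      (𝓝 (∫ _ : ℝ, (0 : ℝ))) by rw [e]; simpa using H
  refine tendsto_integral_filter_of_dominated_convergence
    -- The factor `l` absorbs the `1/l` of the flux bound: for `l < 1`, `2(4l + 1) ≤ 10`.
    (fun x => 10 * exp 2 * exp (-2 * |x|)) ?_ ?_
    ((integrable_exp_mul_abs (by norm_num)).const_mul _) ?_
  · filter_upwards [hpos] with l hl
    exact (((expBdd_flux.mul expBdd_frontSum).cont l hl).const_mul l).aestronglyMeasurable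
  · filter_upwards [hpos, hle] with l hl hl1
    refine .of_forall fun x => ?_
    have h1 := abs_flux_le_exp hl x
    have h2 := abs_frontSum_le_two l x
    have h3 : exp (2 * (l - |x|)) ≤ exp 2 * exp (-2 * |x|) := by
      rw [← exp_add]; apply exp_le_exp.2; linarith
    rw [norm_eq_abs, abs_mul, abs_mul, abs_of_pos hl]
    calc l * (|flux l x| * |frontSum l x|)
        ≤ l * ((4 + 1 / l) * exp (2 * (l - |x|)) * 2) := by gcongr
      _ = (4 * l + 1) * 2 * exp (2 * (l - |x|)) := by field_simp
      _ ≤ 10 * (exp 2 * exp (-2 * |x|)) := by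
        gcongr
        linarith
      _ = _ := by ring
  · refine .of_forall fun x => ?_
    have h0 : Tendsto (fun l : ℝ => l * 8) (𝓝[>] 0) (𝓝 (0 * 8)) :=
      (tendsto_nhdsWithin_of_tendsto_nhds tendsto_id).mul_const 8
    rw [zero_mul] at h0
    refine squeeze_zero_norm' ?_ h0
    filter_upwards [hpos] with l hl
    rw [norm_eq_abs, abs_mul, abs_mul, abs_of_pos hl]
    have h1 := abs_flux_le hl x
    have h2 := abs_frontSum_le_two l x
    have : |flux l x| * |frontSum l x| ≤ 4 * 2 := by gcongr
    nlinarith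

/-- Expansion `1/sinh² y = 4 ∑ n e^{-2ny}`, from the differentiated geometric series. -/
theorem hasSum_mul_sq_mul_exp {t : ℝ} (ht : 0 < t) :
    HasSum (fun n : ℕ => 64 * n * (t ^ 2 * exp (-(4 * n * t)))) (16 * t ^ 2 / sinh (2 * t) ^ 2) := by
  have hlt : exp (-4 * t) < 1 := exp_lt_one_iff.2 (by linarith)
  have h := (hasSum_coe_mul_geometric_of_norm_lt_one (𝕜 := ℝ) (r := exp (-4 * t))
    (by rwa [norm_eq_abs, abs_of_pos (exp_pos _)])).mul_left (64 * t ^ 2)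
  convert! h using 1
  · funext n
    rw [← exp_nat_mul]
    have : exp (-(4 * n * t)) = exp (n * (-4 * t)) := by congr 1; ring
    rw [this]; ring
  · have e1 : exp (-4 * t) = exp (-(2 * t)) ^ 2 := by rw [← exp_nat_mul]; congr 1; push_cast; ring
    have e2 : exp (2 * t) * exp (-(2 * t)) = 1 := by rw [← exp_add]; simp
    have hs := (sinh_pos_iff.2 (by linarith : 0 < 2 * t)).ne'
    have e3 : 1 - exp (-4 * t) = 2 * exp (-(2 * t)) * sinh (2 * t) := by
      rw [sinh_eq, e1]; linear_combination -e2
    rw [e3, e1]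
    have := exp_pos (-(2 * t))
    field_simp
    norm_num

theorem integral_sq_mul_exp {n : ℕ} (hn : n ≠ 0) :
    ∫ t in Set.Ioi (0 : ℝ), t ^ 2 * exp (-(4 * n * t)) = 2 / (4 * n) ^ 3 := by
  have hn' : (0 : ℝ) < n := by positivity
  have h := Real.integral_rpow_mul_exp_neg_mul_Ioi (a := 3) (r := 4 * n) (by norm_num)
    (by positivity)
  have e : ∀ t : ℝ, t ^ ((3 : ℝ) - 1) = t ^ 2 := fun t => by
    rw [show (3 : ℝ) - 1 = (2 : ℕ) by norm_num, rpow_natCast]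
  have g : Real.Gamma 3 = 2 := by
    rw [show (3 : ℝ) = (2 : ℕ) + 1 by norm_num, Real.Gamma_nat_eq_factorial]; simp
  simp only [e, g] at h
  rw [h, show (3 : ℝ) = (3 : ℕ) by norm_num, rpow_natCast]
  field_simp

theorem integrableOn_mul_sq_mul_exp (n : ℕ) :
    IntegrableOn (fun t : ℝ => 64 * n * (t ^ 2 * exp (-(4 * n * t)))) (Set.Ioi 0) := by
  rcases eq_or_ne n 0 with rfl | hn
  · simp
  · have hn' : (0 : ℝ) < n := by positivity
    -- The integral of a non-integrable function is 0 by convention, so a nonzero value proves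
    -- integrability.
    exact Integrable.const_mul (.of_integral_ne_zero (by
      rw [integral_sq_mul_exp hn]; positivity)) _

theorem integral_mul_sq_mul_exp (n : ℕ) :
    ∫ t in Set.Ioi (0 : ℝ), 64 * n * (t ^ 2 * exp (-(4 * n * t))) = 2 * (1 / (n : ℝ) ^ 2) := by
  rw [integral_const_mul]
  rcases eq_or_ne n 0 with rfl | hn
  · simp
  · have hn' : (0 : ℝ) < n := by positivity
    rw [integral_sq_mul_exp hn]
    field_simp
    norm_num

theorem norm_mul_sq_mul_exp (n : ℕ) (t : ℝ) :
    ‖64 * n * (t ^ 2 * exp (-(4 * n * t)))‖ = 64 * n * (t ^ 2 * exp (-(4 * n * t))) := by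
  rw [norm_of_nonneg]; positivity

theorem hasSum_integral_mul_sq_mul_exp :
    HasSum (fun n : ℕ => ∫ t in Set.Ioi (0 : ℝ), 64 * n * (t ^ 2 * exp (-(4 * n * t))))
      (π ^ 2 / 3) := by
  simp only [integral_mul_sq_mul_exp]
  convert! hasSum_zeta_two.mul_left 2 using 1
  ring

/-- Termwise integration of nonnegative terms gives `∑ 2/n² = 2ζ(2)`. -/
theorem integral_sq_div_sinh_sq :
    ∫ t in Set.Ioi (0 : ℝ), 16 * t ^ 2 / sinh (2 * t) ^ 2 = π ^ 2 / 3 := by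
  have h := hasSum_integral_of_summable_integral_norm (μ := volume.restrict (Set.Ioi (0 : ℝ)))
    (F := fun (n : ℕ) (t : ℝ) => 64 * n * (t ^ 2 * exp (-(4 * n * t))))
    integrableOn_mul_sq_mul_exp
    (by simp only [norm_mul_sq_mul_exp]; exact hasSum_integral_mul_sq_mul_exp.summable)
  rw [← h.unique hasSum_integral_mul_sq_mul_exp]
  exact setIntegral_congr_fun measurableSet_Ioi fun t ht => (hasSum_mul_sq_mul_exp ht).tsum_eq.symm

theorem integrableOn_sq_div_sinh_sq :
    IntegrableOn (fun t : ℝ => 16 * t ^ 2 / sinh (2 * t) ^ 2) (Set.Ioi 0) := by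
  refine .of_integral_ne_zero ?_
  rw [integral_sq_div_sinh_sq]
  positivity

theorem one_sub_inv_amp_sq {l : ℝ} (hl : 0 < l) : 1 - 1 / amp l ^ 2 = -(1 / sinh (2 * l) ^ 2) := by
  have h1 := (cosh_pos (2 * l)).ne'
  have h2 := (sinh_pos_iff.2 (by linarith : 0 < 2 * l)).ne'
  rw [amp, tanh_eq_sinh_div_cosh, div_pow, cosh_sq]
  field_simp
  ring

/-- Integrate the derivative from `0`, where the moment vanishes, and complete the integral to the
half-line. -/
theorem fluxMoment_eq {l : ℝ} (hl : 0 < l) :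
    fluxMoment l = 4 * l - π ^ 2 / 3 + ∫ t in Set.Ioi l, 16 * t ^ 2 / sinh (2 * t) ^ 2 := by
  have hd (t : ℝ) (ht : 0 < t) :
      HasDerivAt (fun t => 4 * t - fluxMoment t) (16 * t ^ 2 / sinh (2 * t) ^ 2) t := by
    refine (((hasDerivAt_id t).const_mul 4).sub (hasDerivAt_fluxMoment ht)).congr_deriv ?_
    rw [one_sub_inv_amp_sq ht]; ring
  have hi := integrableOn_sq_div_sinh_sq
  have h0 : Tendsto (fun t => 4 * t - fluxMoment t) (𝓝[>] 0) (𝓝 (4 * 0 - 0)) :=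
    ((tendsto_nhdsWithin_of_tendsto_nhds tendsto_id).const_mul 4).sub tendsto_fluxMoment_zero
  have h := intervalIntegral.integral_eq_sub_of_hasDerivAt_of_tendsto hl
    (fun t ht => hd t ht.1) ((intervalIntegrable_iff_integrableOn_Ioc_of_le hl.le).2
      (hi.mono_set Set.Ioc_subset_Ioi_self)) h0
    ((hd l hl).continuousAt.tendsto.mono_left nhdsWithin_le_nhds)
  rw [intervalIntegral.integral_of_le hl.le] at h
  have h2 := setIntegral_union (Set.Ioc_disjoint_Ioi le_rfl) measurableSet_Ioi
    (hi.mono_set Set.Ioc_subset_Ioi_self) (hi.mono_set (Set.Ioi_subset_Ioi hl.le))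
  rw [Set.Ioc_union_Ioi_eq_Ioi hl.le, integral_sq_div_sinh_sq, h] at h2
  linarith

theorem exp_le_four_mul_sinh {t : ℝ} (ht : 1 ≤ t) : exp (2 * t) ≤ 4 * sinh (2 * t) := by
  have h1 : exp (-(2 * t)) ≤ 1 := exp_le_one_iff.2 (by linarith)
  have h2 : 2 * t + 1 ≤ exp (2 * t) := add_one_le_exp _
  rw [sinh_eq]; linarith

theorem abs_fluxMoment_sub_le {l : ℝ} (hl : 1 ≤ l) :
    |fluxMoment l - (4 * l - π ^ 2 / 3)| ≤ 128 * exp (-2 * l) := by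
  have hl0 : 0 < l := by linarith
  rw [fluxMoment_eq hl0, add_sub_cancel_left]
  -- For `t ≥ 1` one has `t² ≤ e^{2t}` and `1/sinh²(2t) ≤ 16 e^{-4t}`; together with the factor 16
  -- this gives 256.
  have h1 := norm_integral_le_of_norm_le (μ := volume.restrict (Set.Ioi l))
    (f := fun t : ℝ => 16 * t ^ 2 / sinh (2 * t) ^ 2) (g := fun t => 256 * exp (-2 * t))
    ((integrableOn_exp_mul_Ioi (by norm_num) l).const_mul 256) (by
      refine (ae_restrict_iff' measurableSet_Ioi).2 (.of_forall fun t ht => ?_)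
      have ht1 : 1 ≤ t := hl.trans (le_of_lt ht)
      rw [norm_of_nonneg (by positivity)]
      have h2 := exp_le_four_mul_sinh ht1
      have h3 : t ≤ exp t := by linarith [add_one_le_exp t]
      have h4 := exp_pos (2 * t)
      have h5 : 0 < sinh (2 * t) := by linarith
      rw [div_le_iff₀ (by positivity)]
      have h6 : exp (2 * t) ^ 2 ≤ 16 * sinh (2 * t) ^ 2 := by nlinarith
      have h7 : exp (-2 * t) * exp (2 * t) ^ 2 = exp t ^ 2 := by
        rw [← exp_nat_mul, ← exp_nat_mul, ← exp_add]; congr 1; push_cast; ring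
      have h8 : t ^ 2 ≤ exp t ^ 2 := by gcongr
      nlinarith [exp_pos (-2 * t)])
  rw [integral_const_mul, integral_exp_mul_Ioi (by norm_num)] at h1
  rw [norm_eq_abs] at h1
  linarith

/-! ### Reduction of the coefficient by integration by parts. -/

/-- The logarithmic derivative of the squared pulse with respect to the half-width. -/
def logSpeed (l x : ℝ) : ℝ := 4 / amp l - 2 * amp l - bump l x

/-- The integrand of the coefficient, in terms of the half-width. -/
def coefIntegrand (l x : ℝ) : ℝ :=
  (pulse l x ^ 2 * corrector l x + 2 * pulse l x ^ 3 * corrector l x ^ 2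
    - pulse l x * corrector l x ^ 2 - freq l * corrector l x) *
    (pulse l x * logSpeed l x / 2 / amp l)

/-- The density of the exponentially small part of the coefficient. -/
def smallDensity (l x : ℝ) : ℝ :=
  9 / 64 * flux l x ^ 2 + 9 / 32 * (amp l * (slope l x ^ 2 * bump l x)) -
    2 * (phase l x ^ 2 * ((3 / 8) ^ 2 * (amp l ^ 2 * (bump l x * bump l x)) -
      (3 / 8) ^ 3 * (amp l ^ 2 * (bump l x * bump l x) * (amp l * bump l x))))

/-- Any rate below 4 in `l` would do, since the density is multiplied by `1/sinh²(2l)`, which is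
`O(e^{-4l})`. -/
theorem exists_expBdd_smallDensity : ∃ f', ExpBdd 3 (-(1 / 4)) smallDensity f' := by
  obtain ⟨p', hp⟩ := exists_expBdd_phase
  have hb : ExpBdd (1 / 2) (-(1 / 2)) bump _ := expBdd_bump (by norm_num) (by norm_num)
  have h0 : ExpBdd 0 0 (fun l x => amp l * bump l x) _ :=
    (expBdd_amp.mul expBdd_bump₀).mono (by norm_num) (by norm_num)
  have hflux : ExpBdd (1 / 2) (-(1 / 2)) flux _ :=
    ((expBdd_slope.mul hb).mono (by norm_num) (by norm_num)).congr
      (fun l hl x => flux_eq hl x) fun _ _ _ => rfl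
  have h1 := (hflux.pow_two.const_mul (9 / 64)).mono (a₂ := 3) (k₂ := -(1 / 4))
    (by norm_num) (by norm_num)
  have h2 := ((expBdd_amp.mul (expBdd_slope.pow_two.mul hb)).const_mul (9 / 32)).mono
    (a₂ := 3) (k₂ := -(1 / 4)) (by norm_num) (by norm_num)
  have h3 : ExpBdd (1 / 2) (-(1 / 2)) (fun l x => amp l ^ 2 * (bump l x * bump l x)) _ :=
    (expBdd_amp.pow_two.mul (hb.mul expBdd_bump₀)).mono (by norm_num) (by norm_num)
  have h4 : ExpBdd (1 / 2) (-(1 / 2))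
      (fun l x => amp l ^ 2 * (bump l x * bump l x) * (amp l * bump l x)) _ :=
    (h3.mul h0).mono (by norm_num) (by norm_num)
  have h5 := ((hp.pow_two.mul ((h3.const_mul ((3 / 8) ^ 2)).sub
    (h4.const_mul ((3 / 8) ^ 3)))).const_mul 2).mono
    (a₂ := 3) (k₂ := -(1 / 4)) (by norm_num) (by norm_num)
  exact ⟨_, (h1.add h2).sub h5⟩

theorem two_div_amp_sub_bump {l : ℝ} (hl : 0 < l) (x : ℝ) :
    2 / amp l - bump l x
      = bump l x * (cosh (2 * l) * cosh (2 * x) + 1) / sinh (2 * l) ^ 2 := by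
  have h1 := cosh_pos (2 * l)
  have h2 := (sinh_pos_iff.2 (by linarith : 0 < 2 * l)).ne'
  have h3 := cosh_pos (2 * x)
  have h4 : cosh (2 * x) + cosh (2 * l) ≠ 0 := by positivity
  rw [bump_eq, amp, tanh_eq_sinh_div_cosh]
  field_simp
  linear_combination cosh_sq (2 * l)

theorem one_sub_amp_sq {l : ℝ} (hl : 0 < l) :
    1 - amp l ^ 2 = amp l ^ 2 * (1 / sinh (2 * l) ^ 2) := by
  have := one_sub_inv_amp_sq hl
  have hT := (amp_pos hl).ne'
  rw [← neg_neg (1 / sinh (2 * l) ^ 2), ← this]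
  field_simp
  ring

/-- `logSpeed` is `2/T - bump` plus a multiple of `1 - T²`, and `2/T - bump` itself contains the
factor `bump`, which turns `slope² bump` into `flux²`. -/
theorem slope_sq_mul_logSpeed {l : ℝ} (hl : 0 < l) (x : ℝ) :
    slope l x ^ 2 * bump l x * logSpeed l x =
      cosh (2 * l) / sinh (2 * l) ^ 2 * (flux l x ^ 2 * cosh (2 * x))
      + 1 / sinh (2 * l) ^ 2 * (flux l x ^ 2 + 2 * amp l * (slope l x ^ 2 * bump l x)) := by
  have h1 := two_div_amp_sub_bump hl x
  have h2 := one_sub_amp_sq hl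
  have hT := (amp_pos hl).ne'
  have e : logSpeed l x = (2 / amp l - bump l x) + 2 / amp l * (1 - amp l ^ 2) := by
    rw [logSpeed]; field_simp; ring
  rw [e, h1, h2, flux_eq hl]
  field_simp
  ring

/-- The function whose derivative is the difference of the two forms of the integrand. -/
def coefPotential (l x : ℝ) : ℝ :=
  9 / 512 * amp l ^ 2 * (bump l x ^ 2 * frontSum l x * phase l x ^ 2)
    + 9 / 128 * amp l * (flux l x * phase l x * logSpeed l x)

/-- The part of the integrand linear in the phase is `flux' · phase · logSpeed` times a constant,
because `r⁴ - θr²` is a multiple of `flux'`. Integrating by parts yields `slope² bump logSpeed` and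
a term in `phase · phase'`. A second integration by parts moves the latter onto `phase²`, where it
cancels the quadratic part of the integrand up to a factor `1 - T²`. -/
theorem hasDerivAt_coefPotential {l : ℝ} (hl : 0 < l) (x : ℝ) :
    HasDerivAt (coefPotential l) (coefIntegrand l x -
      (9 / 64 * (slope l x ^ 2 * bump l x * logSpeed l x)
        - 2 * (1 / sinh (2 * l) ^ 2) * (phase l x ^ 2 * ((3 / 8) ^ 2 * (amp l ^ 2 *
        (bump l x * bump l x)) -
      (3 / 8) ^ 3 * (amp l ^ 2 * (bump l x * bump l x) * (amp l * bump l x)))))) x := by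
  have hT := (amp_pos hl).ne'
  have hlog : HasDerivAt (logSpeed l) (-(-(bump l x * frontSum l x))) x :=
    (hasDerivAt_bump l x).const_sub _
  refine ((((((hasDerivAt_bump l x).pow 2).mul (hasDerivAt_frontSum hl x)).mul
    ((hasDerivAt_phase hl x).pow 2)).const_mul (9 / 512 * amp l ^ 2)).add
    ((((hasDerivAt_flux hl x).mul (hasDerivAt_phase hl x)).mul hlog).const_mul
      (9 / 128 * amp l))).congr_deriv ?_
  simp only [Pi.mul_apply, Pi.pow_apply]
  have hp := pulse_sq hl x
  have e : coefIntegrand l x = (pulse l x ^ 2) * ((pulse l x ^ 2) * phase l x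
      + 2 * (pulse l x ^ 2) ^ 2 * phase l x ^ 2 - (pulse l x ^ 2) * phase l x ^ 2
      - freq l * phase l x) * (logSpeed l x / 2 / amp l) := by
    rw [coefIntegrand, corrector]; ring
  have hs : amp l * frontSum l x ^ 2 = amp l * bump l x ^ 2 + 4 * amp l - 4 * bump l x := by
    rw [frontSum_sq hl]; field_simp
  have h2 := one_sub_amp_sq hl
  have h3 : 1 / sinh (2 * l) ^ 2 = (1 - amp l ^ 2) / amp l ^ 2 := by
    rw [h2]; field_simp
  rw [e, hp, freq, h3, flux_eq hl, logSpeed]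
  field_simp
  -- Only `frontSum_sq` is needed beyond ring identities; the numeral comes from clearing
  -- denominators.
  linear_combination -603979776 * l * bump l x ^ 2 * phase l x ^ 2 * amp l ^ 2 * hs

theorem coefIntegrand_eq {l : ℝ} (hl : 0 < l) (x : ℝ) :
    coefIntegrand l x = deriv (coefPotential l) x
      + (9 / 64 * (cosh (2 * l) / sinh (2 * l) ^ 2) * (flux l x ^ 2 * cosh (2 * x))
        + 1 / sinh (2 * l) ^ 2 * smallDensity l x) := by
  rw [(hasDerivAt_coefPotential hl x).deriv, slope_sq_mul_logSpeed hl, smallDensity]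
  ring

theorem exists_expBdd_logSpeed : ∃ f', ExpBdd 0 0 logSpeed f' :=
  ⟨_, ((((expBdd_inv_amp.const_mul 4).sub (expBdd_amp.const_mul 2)).sub expBdd_bump₀).congr
    (fun l _ x => by rw [logSpeed]; ring) fun _ _ _ => rfl)⟩

theorem integrable_coefIntegrand {l : ℝ} (hl : 0 < l) : Integrable (coefIntegrand l) := by
  obtain ⟨p', hp⟩ := exists_expBdd_phase
  obtain ⟨g', hg⟩ := exists_expBdd_logSpeed
  have hu : ExpBdd 2 (-2) (fun l x => 3 / 8 * (amp l * bump l x)) _ :=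
    ((expBdd_amp.mul expBdd_bump').const_mul (3 / 8)).mono (by norm_num) (by norm_num)
  have hf : ExpBdd 0 0 (fun l _ => freq l) _ :=
    ((expBdd_const (3 / 4)).sub (((expBdd_amp.mul expBdd_inv).const_mul (3 / 8)).mono
      (by norm_num) (by norm_num))).congr (fun l _ _ => by rw [freq]; ring) fun _ _ _ => rfl
  have hu₀ : ExpBdd 0 0 (fun l x => 3 / 8 * (amp l * bump l x)) _ :=
    ((expBdd_amp.mul expBdd_bump₀).const_mul (3 / 8)).mono (by norm_num) (by norm_num)
  have h1 := (hp.mul (hu₀.sub hf)).mono (a₂ := 1) (k₂ := 1 / 4) (by norm_num) (by norm_num)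
  have h2 := (hp.pow_two.mul (((hu₀.mul hu₀).mono (a₂ := 0) (k₂ := 0) (by norm_num)
    (by norm_num)).const_mul 2 |>.sub hu₀)).mono (a₂ := 1) (k₂ := 1 / 4) (by norm_num) (by norm_num)
  refine (((hu.mul (h1.add h2)).mul (hg.mul (expBdd_inv_amp.const_mul (1 / 2)))).integrable
    (by norm_num) hl).congr (.of_forall fun x => ?_)
  have e := pulse_sq hl x
  have e' : coefIntegrand l x = (pulse l x ^ 2) * ((pulse l x ^ 2) * phase l x
      + 2 * (pulse l x ^ 2) ^ 2 * phase l x ^ 2 - (pulse l x ^ 2) * phase l x ^ 2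
      - freq l * phase l x) * (logSpeed l x / 2 / amp l) := by
    rw [coefIntegrand, corrector]; ring
  rw [e', e]
  ring

theorem integral_deriv_coefPotential {l : ℝ} (hl : 0 < l) :
    Integrable (deriv (coefPotential l)) ∧ ∫ x, deriv (coefPotential l) x = 0 := by
  obtain ⟨p', hp⟩ := exists_expBdd_phase
  obtain ⟨g', hg⟩ := exists_expBdd_logSpeed
  obtain ⟨s', hs⟩ := exists_expBdd_smallDensity
  have e (x : ℝ) : deriv (coefPotential l) x = coefIntegrand l x -
      (9 / 64 * (cosh (2 * l) / sinh (2 * l) ^ 2) * (flux l x ^ 2 * cosh (2 * x))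
        + 1 / sinh (2 * l) ^ 2 * smallDensity l x) := by
    rw [coefIntegrand_eq hl]; ring
  have hi : Integrable (deriv (coefPotential l)) := by
    rw [funext e]
    exact (integrable_coefIntegrand hl).sub (((integrable_flux_sq_mul_cosh hl).const_mul _).add
      ((hs.integrable (by norm_num) hl).const_mul _))
  refine ⟨hi, integral_eq_zero_of_hasDerivAt
    (fun x => (hasDerivAt_coefPotential hl x).differentiableAt.hasDerivAt) hi ?_⟩
  have t1 := ((expBdd_bump'.pow_two.mul expBdd_frontSum).mul hp.pow_two).tendsto_cocompact
    (by norm_num) hl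
  have t2 := ((expBdd_flux.mul hp).mul hg).tendsto_cocompact (by norm_num) hl
  have t := (t1.const_mul (9 / 512 * amp l ^ 2)).add (t2.const_mul (9 / 128 * amp l))
  rwa [mul_zero, mul_zero, add_zero] at t

/-- The leading part of the coefficient as a function of the half-width. -/
def coefMain (l : ℝ) : ℝ :=
  9 / 64 * (1 / amp l) * ((2 / amp l - 1 / l) * (fluxMoment l / l) -
    (8 / amp l - 4 / l - (8 * l * (1 - 1 / amp l ^ 2) + 4 / amp l)))

/-- The factor `sinh (2l)` gained in `integral_flux_sq_mul_cosh` compensates `cosh/sinh²` to `1/T`,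
so this term is of order one. -/
theorem integral_coefIntegrand {l : ℝ} (hl : 0 < l) :
    ∫ x, coefIntegrand l x
      = coefMain l + 1 / sinh (2 * l) ^ 2 * ∫ x, smallDensity l x := by
  obtain ⟨s', hs⟩ := exists_expBdd_smallDensity
  obtain ⟨h1, h2⟩ := integral_deriv_coefPotential hl
  have i1 : Integrable fun x => 9 / 64 * (cosh (2 * l) / sinh (2 * l) ^ 2) *
      (flux l x ^ 2 * cosh (2 * x)) := (integrable_flux_sq_mul_cosh hl).const_mul _
  have i2 : Integrable fun x => 1 / sinh (2 * l) ^ 2 * smallDensity l x :=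
    (hs.integrable (by norm_num) hl).const_mul _
  have e1 : ∫ x, (deriv (coefPotential l) x
      + (9 / 64 * (cosh (2 * l) / sinh (2 * l) ^ 2) * (flux l x ^ 2 * cosh (2 * x))
        + 1 / sinh (2 * l) ^ 2 * smallDensity l x)) = _ := integral_add h1 (i1.add i2)
  have e2 : ∫ x, (9 / 64 * (cosh (2 * l) / sinh (2 * l) ^ 2) * (flux l x ^ 2 * cosh (2 * x))
        + 1 / sinh (2 * l) ^ 2 * smallDensity l x) = _ := integral_add i1 i2
  have hS := (sinh_pos_iff.2 (by linarith : 0 < 2 * l)).ne'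
  have hc := (cosh_pos (2 * l)).ne'
  have e3 : 1 / amp l = cosh (2 * l) / sinh (2 * l) := by
    rw [amp, tanh_eq_sinh_div_cosh, one_div_div]
  simp only [coefIntegrand_eq hl]
  rw [e1, e2, h2, integral_const_mul, integral_const_mul, integral_flux_sq_mul_cosh hl,
    integral_flux_mul_frontSum_mul_bump hl, coefMain, e3, fluxMoment,
    mul_div_cancel_left₀ _ hl.ne']
  field_simp
  ring

/-! ### Derivative of the coefficient and its asymptotics in `l`. -/

/-- The coefficient as a function of the half-width. -/
def coef (l : ℝ) : ℝ := coefMain l + (1 / amp l ^ 2 - 1) * ∫ x, smallDensity l x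

theorem inv_amp_sq_sub_one {l : ℝ} (hl : 0 < l) : 1 / amp l ^ 2 - 1 = 1 / sinh (2 * l) ^ 2 := by
  linarith [one_sub_inv_amp_sq hl]

theorem integral_coefIntegrand_eq_coef {l : ℝ} (hl : 0 < l) :
    ∫ x, coefIntegrand l x = coef l := by
  rw [integral_coefIntegrand hl, coef, inv_amp_sq_sub_one hl]

theorem hasDerivAt_inv_amp {l : ℝ} (hl : 0 < l) :
    HasDerivAt (fun l => 1 / amp l) (-2 * (1 / amp l ^ 2 - 1)) l := by
  refine (expBdd_inv_amp.deriv l hl 0).congr_deriv ?_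
  have := (amp_pos hl).ne'
  field_simp

theorem hasDerivAt_inv_amp_sq_sub_one {l : ℝ} (hl : 0 < l) :
    HasDerivAt (fun l => 1 / amp l ^ 2 - 1) (-4 * (1 / amp l) * (1 / amp l ^ 2 - 1)) l := by
  have h := ((hasDerivAt_inv_amp hl).pow 2).sub_const 1
  have e : (fun l => 1 / amp l ^ 2 - 1) = fun l => (1 / amp l) ^ 2 - 1 := by
    funext l; rw [one_div_pow]
  rw [e]
  refine h.congr_deriv ?_
  push_cast
  ring

/-- The derivative of `coefMain`. -/
def coefMainDeriv (l : ℝ) : ℝ :=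
  9 / 64 * (-2 * (1 / amp l ^ 2 - 1) * ((2 * (1 / amp l) - 1 / l) * (fluxMoment l * (1 / l))
      - 4 * (1 / amp l) + 4 * (1 / l) - 8 * (l * (1 / amp l ^ 2 - 1)))
    + 1 / amp l * (-4 * (1 / amp l ^ 2 - 1) * (fluxMoment l * (1 / l)))
    + 1 / amp l * ((2 * (1 / amp l) - 1 / l) * (-16 * (l * (1 / amp l ^ 2 - 1))))
    + 32 * (1 / amp l) ^ 2 * (l * (1 / amp l ^ 2 - 1))
    + 1 / amp l * ((1 / l) ^ 2 * (fluxMoment l * (1 / l))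
      + (2 * (1 / amp l) - 1 / l) * (4 * (1 / l) - fluxMoment l * (1 / l) * (1 / l))
      - 4 * (1 / l) ^ 2))

theorem hasDerivAt_coefMain {l : ℝ} (hl : 0 < l) :
    HasDerivAt coefMain (coefMainDeriv l) l := by
  have hk := hasDerivAt_inv_amp hl
  have he := hasDerivAt_inv_amp_sq_sub_one hl
  have hv : HasDerivAt (fun l : ℝ => 1 / l) (-(1 / l ^ 2)) l := expBdd_inv.deriv l hl 0
  have hY := hasDerivAt_fluxMoment hl
  have h := (hk.const_mul (9 / 64)).mul (((((hk.const_mul 2).sub hv).mul (hY.mul hv)).sub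
    (hk.const_mul 4)).add (((hv.const_mul 4)).sub (((hasDerivAt_id l).mul he).const_mul 8)))
  have e : coefMain = fun l => 9 / 64 * (1 / amp l) * (((2 * (1 / amp l) - 1 / l) *
      (fluxMoment l * (1 / l)) - 4 * (1 / amp l)) + (4 * (1 / l) -
        8 * (l * (1 / amp l ^ 2 - 1)))) := by
    funext l
    rw [coefMain]; ring
  rw [e]
  refine h.congr_deriv ?_
  simp only [Pi.mul_apply, Pi.sub_apply, Pi.add_apply, id]
  rw [coefMainDeriv]
  have hT := (amp_pos hl).ne'
  field_simp
  ring

/-- Inserting `fluxMoment = 4l - π²/3 + remainder` isolates the leading term `(9/64)(2π²/3)/l²`.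
Every term left has a factor `1/T² - 1`, the remainder, or `1/l³`. -/
theorem coefMainDeriv_eq {l : ℝ} (hl : 0 < l) :
    coefMainDeriv l - 3 * π ^ 2 / 32 * (1 / l) ^ 2 =
  9 / 64 * (-2 * (1 / amp l ^ 2 - 1) * ((2 * (1 / amp l) - 1 / l) * (fluxMoment l * (1 / l))
      - 4 * (1 / amp l) + 4 * (1 / l) - 8 * (l * (1 / amp l ^ 2 - 1)))
    + 1 / amp l * (-4 * (1 / amp l ^ 2 - 1) * (fluxMoment l * (1 / l)))
    + 1 / amp l * ((2 * (1 / amp l) - 1 / l) * (-16 * (l * (1 / amp l ^ 2 - 1))))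
    + 32 * (1 / amp l) ^ 2 * (l * (1 / amp l ^ 2 - 1))
    + (1 / l) ^ 2 * (2 * (π ^ 2 / 3) * (1 / amp l ^ 2 - 1) - 2 * (π ^ 2 / 3) * (1 / amp l) * (1 / l)
      + 2 * (1 / amp l) * (fluxMoment l - (4 * l - π ^ 2 / 3)) * (1 / l - 1 / amp l))) := by
  have hT := (amp_pos hl).ne'
  rw [coefMainDeriv]
  field_simp
  ring

theorem exp_neg_le_inv_pow {l : ℝ} (hl : 0 < l) : exp (-l) ≤ 24 * (1 / l) ^ 4 := by
  have h := pow_div_factorial_le_exp l hl.le 4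
  have h24 : ((Nat.factorial 4 : ℕ) : ℝ) = 24 := by norm_num [Nat.factorial]
  rw [h24] at h
  rw [exp_neg, ← one_div, one_div_pow, mul_one_div, div_le_div_iff₀ (exp_pos l) (by positivity)]
  rw [div_le_iff₀ (by norm_num)] at h
  linarith

theorem isBigO_exp_neg (k : ℕ) (hk : k ≤ 4) :
    (fun l : ℝ => exp (-l)) =O[atTop] fun l : ℝ => (1 / l) ^ k := by
  refine IsBigO.of_bound 24 ?_
  filter_upwards [eventually_ge_atTop 1] with l hl
  have hl0 : 0 < l := by linarith
  rw [norm_of_nonneg (exp_pos _).le, norm_of_nonneg (by positivity)]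
  refine (exp_neg_le_inv_pow hl0).trans (mul_le_mul_of_nonneg_left ?_ (by norm_num))
  exact pow_le_pow_of_le_one (by positivity) ((div_le_one hl0).2 hl) hk

theorem inv_amp_sq_sub_one_le {l : ℝ} (hl : 1 ≤ l) :
    |1 / amp l ^ 2 - 1| ≤ 16 * exp (-4 * l) := by
  have hl0 : 0 < l := by linarith
  have h1 := exp_le_four_mul_sinh hl
  have h2 := sinh_pos_iff.2 (by linarith : 0 < 2 * l)
  rw [inv_amp_sq_sub_one hl0, abs_of_pos (by positivity), div_le_iff₀ (by positivity)]
  have h3 : exp (2 * l) ^ 2 ≤ (4 * sinh (2 * l)) ^ 2 := by gcongr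
  have h4 : exp (-4 * l) * exp (2 * l) ^ 2 = 1 := by
    rw [← exp_nat_mul, ← exp_add]; simp; ring
  nlinarith [exp_pos (-4 * l)]

theorem isBigO_inv_amp_sq_sub_one :
    (fun l : ℝ => 1 / amp l ^ 2 - 1) =O[atTop] fun l : ℝ => (1 / l) ^ 4 := by
  refine IsBigO.trans (IsBigO.of_bound 16 ?_) (isBigO_exp_neg 4 le_rfl)
  filter_upwards [eventually_ge_atTop 1] with l hl
  rw [norm_eq_abs, norm_of_nonneg (exp_pos _).le]
  refine (inv_amp_sq_sub_one_le hl).trans ?_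
  have : exp (-4 * l) ≤ exp (-l) := exp_le_exp.2 (by linarith)
  linarith

theorem isBigO_inv_one : (fun l : ℝ => 1 / l) =O[atTop] fun _ : ℝ => (1 : ℝ) := by
  refine IsBigO.of_bound 1 ?_
  filter_upwards [eventually_ge_atTop 1] with l hl
  rw [norm_of_nonneg (by positivity)]
  simpa using inv_le_one_of_one_le₀ hl

theorem isBigO_inv_amp : (fun l : ℝ => 1 / amp l) =O[atTop] fun _ : ℝ => (1 : ℝ) := by
  refine IsBigO.of_bound (1 / amp 1) ?_
  filter_upwards [eventually_ge_atTop 1] with l hl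
  have h1 := amp_pos one_pos
  have h2 := amp_mono hl
  rw [norm_of_nonneg (by have := h1.trans_le h2; positivity)]
  simp only [norm_one, mul_one]
  gcongr

theorem isBigO_fluxMoment_sub :
    (fun l : ℝ => fluxMoment l - (4 * l - π ^ 2 / 3)) =O[atTop] fun l : ℝ => 1 / l := by
  refine IsBigO.trans (IsBigO.of_bound 128 ?_) ((isBigO_exp_neg 1 (by norm_num)).congr_right
    fun l => pow_one _)
  filter_upwards [eventually_ge_atTop 1] with l hl
  rw [norm_eq_abs, norm_of_nonneg (exp_pos _).le]
  refine (abs_fluxMoment_sub_le hl).trans ?_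
  have : exp (-2 * l) ≤ exp (-l) := exp_le_exp.2 (by linarith)
  linarith

theorem isBigO_fluxMoment_div :
    (fun l : ℝ => fluxMoment l * (1 / l)) =O[atTop] fun _ : ℝ => (1 : ℝ) := by
  have h1 := (isBigO_fluxMoment_sub.trans isBigO_inv_one).mul isBigO_inv_one
  have h2 : (fun l : ℝ => (4 : ℝ) - π ^ 2 / 3 * (1 / l)) =O[atTop] fun _ : ℝ => (1 : ℝ) :=
    (isBigO_const_const _ one_ne_zero _).sub (isBigO_inv_one.const_mul_left _)
  simp only [mul_one] at h1
  refine (h1.add h2).congr' ?_ .rfl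
  filter_upwards [eventually_gt_atTop 0] with l hl
  field_simp
  ring

theorem isBigO_mul_inv_amp_sq_sub_one :
    (fun l : ℝ => l * (1 / amp l ^ 2 - 1)) =O[atTop] fun l : ℝ => (1 / l) ^ 3 := by
  refine ((isBigO_refl (fun l : ℝ => l) atTop).mul isBigO_inv_amp_sq_sub_one).congr' .rfl ?_
  filter_upwards [eventually_gt_atTop 0] with l hl
  field_simp

theorem isBigO_inv_pow {m n : ℕ} (h : n ≤ m) :
    (fun l : ℝ => (1 / l) ^ m) =O[atTop] fun l : ℝ => (1 / l) ^ n := by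
  refine IsBigO.of_bound 1 ?_
  filter_upwards [eventually_ge_atTop 1] with l hl
  have hl0 : 0 < l := by linarith
  rw [norm_of_nonneg (by positivity), norm_of_nonneg (by positivity), one_mul]
  exact pow_le_pow_of_le_one (by positivity) ((div_le_one hl0).2 hl) h

theorem isBigO_coefMainDeriv_sub :
    (fun l : ℝ => coefMainDeriv l - 3 * π ^ 2 / 32 * (1 / l) ^ 2) =O[atTop]
      fun l : ℝ => (1 / l) ^ 3 := by
  have e := isBigO_inv_amp_sq_sub_one.trans (isBigO_inv_pow (show 3 ≤ 4 by norm_num))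
  have e1 := isBigO_inv_amp_sq_sub_one.trans (isBigO_inv_pow (show 1 ≤ 4 by norm_num))
  have le := isBigO_mul_inv_amp_sq_sub_one
  have le0 := le.trans (isBigO_inv_pow (show 0 ≤ 3 by norm_num))
  simp only [pow_zero] at le0
  simp only [pow_one] at e1
  have k := isBigO_inv_amp
  have v := isBigO_inv_one
  have Y := isBigO_fluxMoment_div
  have kv : (fun l : ℝ => 2 * (1 / amp l) - 1 / l) =O[atTop] fun _ : ℝ => (1 : ℝ) :=
    (k.const_mul_left 2).sub v
  have B := ((((kv.mul Y).congr_right fun _ => mul_one _).sub (k.const_mul_left 4)).add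
    (v.const_mul_left 4)).sub (le0.const_mul_left 8)
  have t1 := ((e.const_mul_left (-2)).mul B).congr_right fun _ => mul_one _
  have t2 := (k.mul ((e.const_mul_left (-4)).mul Y)).congr_right
    (g₂ := fun l : ℝ => (1 / l) ^ 3) fun _ => by ring
  have t3 := (k.mul (kv.mul (le.const_mul_left (-16)))).congr_right
    (g₂ := fun l : ℝ => (1 / l) ^ 3) fun _ => by ring
  have t4 := (((k.pow 2).const_mul_left 32).mul le).congr_right
    (g₂ := fun l : ℝ => (1 / l) ^ 3) fun _ => by ring
  have vv : (fun l : ℝ => 1 / l) =O[atTop] fun l : ℝ => 1 / l := isBigO_refl _ _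
  have t5 := ((isBigO_refl (fun l : ℝ => (1 / l) ^ 2) atTop).mul
    (((e1.const_mul_left (2 * (π ^ 2 / 3))).sub
      (((k.const_mul_left (2 * (π ^ 2 / 3))).mul vv).congr_right fun _ => one_mul _)).add
      ((((k.const_mul_left 2).mul isBigO_fluxMoment_sub).mul (v.sub k)).congr_right
        (g₂ := fun l : ℝ => 1 / l) fun _ => by ring))).congr_right
        (g₂ := fun l : ℝ => (1 / l) ^ 3) fun _ => by ring
  refine (((((t1.add t2).add t3).add t4).add t5).const_mul_left (9 / 64)).congr' ?_ .rfl
  filter_upwards [eventually_gt_atTop 0] with l hl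
  exact (coefMainDeriv_eq hl).symm

/-- The product is `O(e^{-4l} e^{3l}) = O(e^{-l})`. -/
theorem isBigO_inv_amp_sq_sub_one_mul {q : ℝ → ℝ} {C : ℝ}
    (hq : ∀ l, 1 ≤ l → |q l| ≤ C * exp (3 * l)) :
    (fun l : ℝ => (1 / amp l ^ 2 - 1) * q l) =O[atTop] fun l : ℝ => (1 / l) ^ 3 := by
  refine IsBigO.trans (IsBigO.of_bound (16 * C) ?_) (isBigO_exp_neg 3 (by norm_num))
  filter_upwards [eventually_ge_atTop 1] with l hl
  rw [norm_eq_abs, norm_of_nonneg (exp_pos _).le, abs_mul]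
  refine (mul_le_mul (inv_amp_sq_sub_one_le hl) (hq l hl) (abs_nonneg _)
    (by positivity)).trans_eq ?_
  have : exp (-4 * l) * exp (3 * l) = exp (-l) := by rw [← exp_add]; congr 1; ring
  rw [← this]; ring

/-- The factor `1 / amp l` is `dl/dL`, so the estimated product is already the derivative in `L`. -/
theorem exists_hasDerivAt_coef : ∃ D : ℝ → ℝ, (∀ l, 0 < l → HasDerivAt coef (D l) l) ∧
    (fun l : ℝ => D l * (1 / amp l) - 3 * π ^ 2 / (32 * l ^ 2)) =O[atTop]
      fun l : ℝ => (1 / l) ^ 3 := by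
  obtain ⟨s', hs⟩ := exists_expBdd_smallDensity
  have hq := hs.integral (by norm_num)
  obtain ⟨C, -, H⟩ := hq.bound 1 one_pos
  simp only [zero_mul, add_zero] at H
  refine ⟨fun l => coefMainDeriv l + ((-4 * (1 / amp l) * (1 / amp l ^ 2 - 1)) *
      (∫ x, smallDensity l x) + (1 / amp l ^ 2 - 1) * ∫ x, s' l x),
    fun l hl => (hasDerivAt_coefMain hl).add
      ((hasDerivAt_inv_amp_sq_sub_one hl).mul (hq.deriv l hl 0)), ?_⟩
  have k := isBigO_inv_amp
  have h1 := isBigO_inv_amp_sq_sub_one_mul fun l hl => (H l hl 0).1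
  have h2 := isBigO_inv_amp_sq_sub_one_mul fun l hl => (H l hl 0).2
  have h3 := ((k.const_mul_left (-4)).mul h1).congr_right
    (g₂ := fun l : ℝ => (1 / l) ^ 3) fun _ => by ring
  have h4 := ((isBigO_coefMainDeriv_sub.add (h3.add h2)).mul k).congr_right
    (g₂ := fun l : ℝ => (1 / l) ^ 3) fun _ => by ring
  -- Since `1/T ≥ 1`, one has `0 ≤ 1/T - 1 ≤ 1/T² - 1`.
  have h5 : (fun l : ℝ => 1 / amp l - 1) =O[atTop] fun l : ℝ => (1 / l) ^ 3 := by
    refine IsBigO.trans (IsBigO.of_bound 1 ?_)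
      (isBigO_inv_amp_sq_sub_one.trans (isBigO_inv_pow (show 3 ≤ 4 by norm_num)))
    filter_upwards [eventually_gt_atTop 0] with l hl
    have ha := amp_pos hl
    have hk : 1 ≤ 1 / amp l := (one_le_div ha).2 (amp_lt_one l).le
    have e : 1 / amp l ^ 2 = (1 / amp l) ^ 2 := (one_div_pow _ _).symm
    rw [e, norm_of_nonneg (by linarith), norm_of_nonneg (by nlinarith)]
    nlinarith
  have h6 := ((isBigO_inv_one.pow 2).const_mul_left (3 * π ^ 2 / 32)).mul h5 |>.congr_right
    (g₂ := fun l : ℝ => (1 / l) ^ 3) fun _ => by ring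
  refine (h4.add h6).congr_left fun l => ?_
  ring

/-! ### The half-width as a function of `L`. -/

/-- The half-width as a function of the half-length. -/
def halfWidth (L : ℝ) : ℝ := arcosh (exp (2 * L) / 2) / 2

theorem one_lt_exp_div_two {L : ℝ} (hL : log 4 / 4 < L) : 1 < exp (2 * L) / 2 := by
  have h : log 4 = 2 * log 2 := by
    rw [show (4 : ℝ) = 2 ^ 2 by norm_num, log_pow]; norm_num
  have : exp (log 2) < exp (2 * L) := exp_lt_exp.2 (by linarith)
  rw [exp_log two_pos] at this
  linarith

theorem halfWidth_pos {L : ℝ} (hL : log 4 / 4 < L) : 0 < halfWidth L :=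
  half_pos (arcosh_pos (one_lt_exp_div_two hL))

theorem cosh_two_mul_halfWidth {L : ℝ} (hL : log 4 / 4 < L) :
    cosh (2 * halfWidth L) = exp (2 * L) / 2 := by
  rw [halfWidth, mul_div_cancel₀ _ two_ne_zero, cosh_arcosh (one_lt_exp_div_two hL).le]

theorem nuOf_eq {L : ℝ} (hL : log 4 / 4 < L) : nuOf L = 1 / cosh (2 * halfWidth L) ^ 2 := by
  rw [cosh_two_mul_halfWidth hL, nuOf, div_pow, one_div_div, ← exp_nat_mul,
    show -4 * L = -(((2 : ℕ) : ℝ) * (2 * L)) by push_cast; ring, exp_neg]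
  norm_num [div_eq_mul_inv]

theorem nuOf_lt_one {L : ℝ} (hL : log 4 / 4 < L) : nuOf L < 1 := by
  have h : 1 < cosh (2 * halfWidth L) := one_lt_cosh.2 (by have := halfWidth_pos hL; positivity)
  rw [nuOf_eq hL, div_lt_one (by positivity)]
  nlinarith

theorem nuOf_pos (L : ℝ) : 0 < nuOf L := by unfold nuOf; positivity

theorem mass_eq_amp_sq {ν l : ℝ} (h : ν = 1 / cosh (2 * l) ^ 2) :
    mass ν = 3 / 16 * amp l ^ 2 := by
  rw [mass, h, amp_sq]

theorem exists_halfWidth {ν : ℝ} (h0 : 0 < ν) (h1 : ν < 1) :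
    ∃ l, 0 < l ∧ ν = 1 / cosh (2 * l) ^ 2 := by
  have hs : 0 < √ν := sqrt_pos.2 h0
  have hs1 : √ν < 1 := by rw [sqrt_lt' one_pos]; simpa using h1
  have h : 1 < 1 / √ν := (one_lt_div hs).2 hs1
  refine ⟨arcosh (1 / √ν) / 2, half_pos (arcosh_pos h), ?_⟩
  rw [mul_div_cancel₀ _ two_ne_zero, cosh_arcosh h.le, one_div_pow, one_div_one_div, sq_sqrt h0.le]

/-- Differentiating `cosh (2l) = e^{2L}/2` gives `l' = coth (2l)`. -/
theorem hasDerivAt_halfWidth {L : ℝ} (hL : log 4 / 4 < L) :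
    HasDerivAt halfWidth (1 / amp (halfWidth L)) L := by
  have h1 := one_lt_exp_div_two hL
  have hd : HasDerivAt (fun L : ℝ => exp (2 * L) / 2) (exp (2 * L) * (2 * 1) / 2) L :=
    (((hasDerivAt_id L).const_mul 2).exp).div_const 2
  refine (((hasDerivAt_arcosh h1).comp L hd).div_const 2).congr_deriv ?_
  have e : 2 * halfWidth L = arcosh (exp (2 * L) / 2) := by rw [halfWidth]; ring
  rw [amp, e, tanh_arcosh h1.le, one_div_div]
  have : 0 < √((exp (2 * L) / 2) ^ 2 - 1) := sqrt_pos.2 (by nlinarith)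
  field_simp

theorem halfWidth_le {L : ℝ} (hL : log 4 / 4 < L) : halfWidth L ≤ L := by
  have h := cosh_two_mul_halfWidth hL
  rw [cosh_eq] at h
  have : exp (2 * halfWidth L) ≤ exp (2 * L) := by
    have := exp_pos (-(2 * halfWidth L)); linarith
  linarith [exp_le_exp.1 this]

theorem le_halfWidth_add_one {L : ℝ} (hL : log 4 / 4 < L) : L ≤ halfWidth L + 1 := by
  have h := cosh_two_mul_halfWidth hL
  have hl := halfWidth_pos hL
  rw [cosh_eq] at h
  have h1 : exp (-(2 * halfWidth L)) ≤ exp (2 * halfWidth L) := exp_le_exp.2 (by linarith)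
  have h2 : (2 : ℝ) ≤ exp 2 := by linarith [add_one_le_exp (2 : ℝ)]
  have h3 : exp (2 * L) ≤ exp (2 * halfWidth L + 2) := by
    rw [exp_add]; nlinarith [exp_pos (2 * halfWidth L)]
  linarith [exp_le_exp.1 h3]

theorem tendsto_halfWidth : Tendsto halfWidth atTop atTop := by
  refine tendsto_atTop_mono' atTop ?_ (tendsto_atTop_add_const_right atTop (-1 : ℝ) tendsto_id)
  filter_upwards [eventually_gt_atTop (log 4 / 4)] with L hL
  have := le_halfWidth_add_one hL
  simp only [id]; linarith

theorem isBigO_inv_halfWidth :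
    (fun L => 1 / halfWidth L) =O[atTop] fun L : ℝ => 1 / L := by
  refine IsBigO.of_bound 2 ?_
  filter_upwards [eventually_gt_atTop (log 4 / 4), eventually_ge_atTop 2] with L hL h2
  have h1 := le_halfWidth_add_one hL
  have hl := halfWidth_pos hL
  have hL0 : 0 < L := by linarith
  rw [norm_of_nonneg (by positivity), norm_of_nonneg (by positivity), mul_one_div,
    div_le_div_iff₀ hl hL0]
  linarith

/-- `1/l² - 1/L² = (L - l)(1/l)(1/L)(1/l + 1/L)`, so boundedness of `L - l` is enough. -/
theorem isBigO_inv_halfWidth_sq_sub :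
    (fun L => 3 * π ^ 2 / (32 * halfWidth L ^ 2) - 3 * π ^ 2 / (32 * L ^ 2)) =O[atTop]
      fun L : ℝ => (1 / L) ^ 3 := by
  have h0 : (fun L => L - halfWidth L) =O[atTop] fun _ : ℝ => (1 : ℝ) := by
    refine IsBigO.of_bound 1 ?_
    filter_upwards [eventually_gt_atTop (log 4 / 4)] with L hL
    rw [norm_of_nonneg (by linarith [halfWidth_le hL])]
    simp only [norm_one, mul_one]
    linarith [le_halfWidth_add_one hL]
  have hv := isBigO_refl (fun L : ℝ => 1 / L) atTop
  have h := ((h0.mul ((isBigO_inv_halfWidth.mul hv).mul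
    (isBigO_inv_halfWidth.add hv))).const_mul_left (3 * π ^ 2 / 32)).congr_right
    (g₂ := fun L : ℝ => (1 / L) ^ 3) fun _ => by ring
  refine h.congr' ?_ .rfl
  filter_upwards [eventually_gt_atTop (log 4 / 4), eventually_gt_atTop 0] with L hL hL0
  have hl := halfWidth_pos hL
  field_simp
  ring

theorem isBigO_inv_cube_rpow :
    (fun L : ℝ => (1 / L) ^ 3) =O[atTop] fun L : ℝ => L ^ (-(5 / 2) : ℝ) := by
  refine IsBigO.of_bound 1 ?_
  filter_upwards [eventually_ge_atTop 1] with L hL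
  have hL0 : 0 < L := by linarith
  rw [norm_of_nonneg (by positivity), norm_of_nonneg (by positivity), one_mul, one_div, inv_pow,
    ← rpow_natCast, ← rpow_neg hL0.le]
  exact rpow_le_rpow_of_exponent_le hL (by norm_num)

/-! ### Transfer to an arbitrary family of solutions. -/

section Family

variable {r : ℝ → ℝ → ℝ} {θ : ℝ → ℝ} {q : ℝ → ℝ → ℝ}

/-- Uniqueness forces any family to be the explicit one, so regularity in `ν` need not be assumed.
-/
theorem family_eq (h : ∀ ν : ℝ, 0 < ν → ν < 1 →
      IsScalarPulse ν (r ν) ∧ IsPhaseCorrector ν (r ν) (θ ν) (q ν)) {L : ℝ} (hL : log 4 / 4 < L) :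
    r (nuOf L) = pulse (halfWidth L) ∧ θ (nuOf L) = freq (halfWidth L) ∧
      q (nuOf L) = corrector (halfWidth L) := by
  obtain ⟨h1, h2⟩ := h _ (nuOf_pos L) (nuOf_lt_one hL)
  have hl := halfWidth_pos hL
  have hm := mass_eq_amp_sq (nuOf_eq hL)
  have e := h1.eq_pulse hl (nuOf_eq hL)
  rw [e] at h2
  exact ⟨e, h2.unique hl hm (isPhaseCorrector_corrector hl hm)⟩

theorem hasDerivAt_family (h : ∀ ν : ℝ, 0 < ν → ν < 1 →
      IsScalarPulse ν (r ν) ∧ IsPhaseCorrector ν (r ν) (θ ν) (q ν)) {L : ℝ} (hL : log 4 / 4 < L)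
    (x : ℝ) : HasDerivAt (fun L' => r (nuOf L') x)
      (pulse (halfWidth L) x * logSpeed (halfWidth L) x / 2 / amp (halfWidth L)) L := by
  have hd := (hasDerivAt_pulse_param (halfWidth_pos hL) x).comp L (hasDerivAt_halfWidth hL)
  rw [mul_one_div] at hd
  refine hd.congr_of_eventuallyEq ?_
  filter_upwards [lt_mem_nhds hL] with L' hL'
  rw [(family_eq h hL').1]
  rfl

theorem integrand_eq (h : ∀ ν : ℝ, 0 < ν → ν < 1 →
      IsScalarPulse ν (r ν) ∧ IsPhaseCorrector ν (r ν) (θ ν) (q ν)) {L : ℝ} (hL : log 4 / 4 < L) :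
    integrand r θ q L = coefIntegrand (halfWidth L) := by
  funext x
  obtain ⟨h1, h2, h3⟩ := family_eq h hL
  rw [integrand, sigma, (hasDerivAt_family h hL x).deriv, h1, h2, h3, coefIntegrand]

theorem hasDerivAt_aCoeff (h : ∀ ν : ℝ, 0 < ν → ν < 1 →
      IsScalarPulse ν (r ν) ∧ IsPhaseCorrector ν (r ν) (θ ν) (q ν)) {D : ℝ → ℝ}
    (hD : ∀ l, 0 < l → HasDerivAt coef (D l) l) {L : ℝ} (hL : log 4 / 4 < L) :
    HasDerivAt (aCoeff r θ q) (D (halfWidth L) * (1 / amp (halfWidth L))) L := by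
  refine ((hD _ (halfWidth_pos hL)).comp L (hasDerivAt_halfWidth hL)).congr_of_eventuallyEq ?_
  filter_upwards [lt_mem_nhds hL] with L' hL'
  rw [aCoeff, integrand_eq h hL', integral_coefIntegrand_eq_coef (halfWidth_pos hL')]
  rfl

end Family

end QuinticGL

end

theorem theorem5p7 :
    -- for every `ν ∈ (0,1)` the pulse `r` and the pair `(θ, q)` exist and are unique
    (∀ ν : ℝ, 0 < ν → ν < 1 →
      (∃! r : ℝ → ℝ, QuinticGL.IsScalarPulse ν r) ∧
      ∀ r : ℝ → ℝ, QuinticGL.IsScalarPulse ν r →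
        ∃! p : ℝ × (ℝ → ℝ), QuinticGL.IsPhaseCorrector ν r p.1 p.2) ∧
    -- and for these `r`, `θ`, `q`, as functions of `ν`:
    ∀ (r : ℝ → ℝ → ℝ) (θ : ℝ → ℝ) (q : ℝ → ℝ → ℝ),
      (∀ ν : ℝ, 0 < ν → ν < 1 →
        QuinticGL.IsScalarPulse ν (r ν) ∧ QuinticGL.IsPhaseCorrector ν (r ν) (θ ν) (q ν)) →
      (∀ L : ℝ, Real.log 4 / 4 < L →
        (∀ x : ℝ, DifferentiableAt ℝ (fun L' => r (QuinticGL.nuOf L') x) L) ∧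
        Integrable (QuinticGL.integrand r θ q L) volume ∧
        DifferentiableAt ℝ (QuinticGL.aCoeff r θ q) L) ∧
      (fun L : ℝ => deriv (QuinticGL.aCoeff r θ q) L - 3 * Real.pi ^ 2 / (32 * L ^ 2))
        =O[atTop] fun L : ℝ => L ^ (-(5 / 2) : ℝ) := by
  open QuinticGL in
  refine ⟨fun ν h0 h1 => ?_, fun r θ q h => ?_⟩
  · obtain ⟨l, hl, hν⟩ := exists_halfWidth h0 h1
    have hm := mass_eq_amp_sq hν
    refine ⟨⟨pulse l, isScalarPulse_pulse hl hm, fun r hr => hr.eq_pulse hl hν⟩, fun r hr => ?_⟩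
    rw [hr.eq_pulse hl hν]
    have hc := isPhaseCorrector_corrector hl hm
    exact ⟨(freq l, corrector l), hc, fun p hp =>
      Prod.ext (hp.unique hl hm hc).1 (hp.unique hl hm hc).2⟩
  · obtain ⟨D, hD, hO⟩ := exists_hasDerivAt_coef
    refine ⟨fun L hL => ⟨fun x => (hasDerivAt_family h hL x).differentiableAt, ?_,
      (hasDerivAt_aCoeff h hD hL).differentiableAt⟩, ?_⟩
    · rw [integrand_eq h hL]
      exact integrable_coefIntegrand (halfWidth_pos hL)
    · have h1 := (hO.comp_tendsto tendsto_halfWidth).trans (isBigO_inv_halfWidth.pow 3)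
      -- The error obtained is `O(L⁻³)`, which is weakened to `O(L^{-5/2})`.
      refine IsBigO.trans ((h1.add isBigO_inv_halfWidth_sq_sub).congr' ?_ .rfl)
        isBigO_inv_cube_rpow
      filter_upwards [eventually_gt_atTop (Real.log 4 / 4)] with L hL
      rw [(hasDerivAt_aCoeff h hD hL).deriv]
      simp only [Function.comp_apply]
      ring
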